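/- Let $G$ be a finite-dimensional real Lie group with identity $e$ and Lie algebra $\mathfrak g=T_eG$, let $H$ be a closed (Lie) subgroup with Lie algebra $\mathfrak h$, and let $\mathcal M=G/H$ carry the manifold structure making $\pi\colon G\to\mathcal M$, $g\mapsto gH$, a smooth submersion. Let $G$ act on $\mathcal M$ by $g.(kH)=\Lambda^g(kH)=(gk)H$. Assume that $\mathcal M$ is reductive: $\mathfrak m\subseteq\mathfrak g$ is a fixed vector subspace with $\mathfrak g=\mathfrak h\oplus\mathfrak m$ and $\mathrm{Ad}(h)\mathfrak m\subseteq\mathfrak m$ for all $h\in H$. Let $I=[0,1]$. For a manifold $N$ let $C^\infty(I,N)$ denote the smooth curves $I\to N$; $C^\infty(I,\mathfrak g)$ is a Fréchet space under uniform convergence of all derivatives, and smoothness of maps on it is meant in the sense of Bastiani (all iterated directional derivatives exist and are jointly continuous). For $q\in C^\infty(I,\mathfrak g)$ let $\mathrm{Evol}(q)\in C^\infty(I,G)$ be the solution $g$ of $\dot g(t)=T_eR_{g(t)}(q(t))$, $g(0)=e$, where $R_g$ is right multiplication by $g$; for $g_0\in G$ put $$\Psi_{g_0}(q)=-\mathrm{Ad}(g_0\,\mathrm{Evol}(q)^{-1}).q\in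 C^\infty(I,\mathfrak g)\quad\text{(pointwise in }t),$$ and for $c_0\in\mathcal M$ put $\rho_{c_0}(q)(t)=\mathrm{Evol}(q)(t).c_0$. Let $\omega_e\colon T_{eH}\mathcal M\to\mathfrak m$ be the inverse of $T_e\pi|_{\mathfrak m}$, let $\omega(v)=\mathrm{Ad}(g).\omega_e(T\Lambda^{g^{-1}}v)$ for $v\in T_{gH}\mathcal M$, and put $\theta_\omega(f)=\omega\circ f$ for $f\in C^\infty(I,T\mathcal M)$ and $D(c)=\dot c$. Let $c_0\in\mathcal M$ and $g_0\in G$ with $\pi(g_0)=c_0$. Then: 1. $\mathrm{Evol}$ and $\omega$ are well defined: the initial value problem has exactly one solution in $C^\infty(I,G)$ for every $q\in C^\infty(I,\mathfrak g)$, and $\omega(v)$ does not depend on the choice of the representative $g$. 2. $\Psi_{g_0}\colon C^\infty(I,\mathfrak g)\to C^\infty(I,\mathfrak g)$ is a diffeomorphism with inverse $\Psi_{g_0^{-1}}$. 3. $\Psi_{g_0}\bigl(C^\infty(I,\mathfrak m\setminus\{0\})\bigr)=\{\theta_\omega(\dot c) : c\in C^\infty(I,\mathcal M),\ c(0)=c_0,\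 \dot c(t)\ne 0\text{ for all }t\in I\}$. 4. $\theta_\omega\circ D\circ\rho_{c_0}\circ\Psi_{g_0}(q)=\Psi_{g_0}(q)$ for every $q\in C^\infty(I,\mathfrak m)$, in particular for every $q\in C^\infty(I,\mathfrak m\setminus\{0\})$. -/

import Mathlib

open scoped Manifold ContDiff Topology

noncomputable section

namespace ReductiveSRVT

/-! Mathlib's tangent spaces are copies of the model space: for a manifold `M` modelled on `F`,
`TangentSpace 𝓘(ℝ, F) x` is `F` by definition (read in the preferred chart at `x`). In particular
the Lie algebra `𝔤 = T_e G` of a Lie group `G` modelled on `E` is, as a vector space, `E`; below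
`𝔤` is therefore written `E`. The unit interval `I = [0,1]` is the Mathlib manifold with boundary
`unitInterval`, with model `𝓡∂ 1`, and `C^∞(I, M)` is the type of bundled smooth maps. -/

/-! ### Smooth curves, their velocities, and the Fréchet space `C^∞(I, V)` -/

section Curves

variable {F : Type*} [NormedAddCommGroup F] [NormedSpace ℝ F]

/-- `C^∞(I, M)`, the smooth curves `I = [0,1] → M`. -/
abbrev SmoothCurve (F : Type*) [NormedAddCommGroup F] [NormedSpace ℝ F]
    (M : Type*) [TopologicalSpace M] [ChartedSpace F M] : Type _ :=
  C^∞⟮𝓡∂ 1, unitInterval; 𝓘(ℝ, F), M⟯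

/-- The velocity `ċ(t) = T_t c (1)` of a curve `c : I → M`, a tangent vector at `c t`. -/
def velocity {M : Type*} [TopologicalSpace M] [ChartedSpace F M] (c : unitInterval → M)
    (t : unitInterval) : TangentSpace 𝓘(ℝ, F) (c t) :=
  mfderiv (𝓡∂ 1) 𝓘(ℝ, F) c t (1 : TangentSpace (𝓡∂ 1) t)

/-- `c` is a smooth immersion `I → M`: its velocity vanishes nowhere. -/
def IsImm {M : Type*} [TopologicalSpace M] [ChartedSpace F M] (c : SmoothCurve F M) : Prop :=
  ∀ t, velocity (F := F) c t ≠ 0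

/-- The `k`-th derivative of a curve `I → V` in a normed space (one-sided at the end points). -/
def curveDeriv {V : Type*} [NormedAddCommGroup V] [NormedSpace ℝ V] (k : ℕ)
    (f : SmoothCurve V V) (t : unitInterval) : V :=
  iteratedDerivWithin k (Set.IccExtend zero_le_one f) (Set.Icc (0 : ℝ) 1) (t : ℝ)

/-- The compact-open `C^∞`-topology on `C^∞(I, V)`: uniform convergence on `I` of all
derivatives. -/
instance smoothCurveTopology {V : Type*} [NormedAddCommGroup V] [NormedSpace ℝ V] :
    TopologicalSpace (SmoothCurve V V) :=
  ⨅ k : ℕ, TopologicalSpace.induced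
    (fun f : SmoothCurve V V => UniformFun.ofFun (curveDeriv k f)) inferInstance

/-- Smoothness in the sense of Bastiani of a map between real topological vector spaces: all
iterated directional derivatives `d k x (v₁, …, v_k) = (D_{v_k} ⋯ D_{v_1} f)(x)` exist, and each
is a jointly continuous function of `x` and the directions. -/
def BastianiSmooth {X Y : Type*} [AddCommGroup X] [Module ℝ X] [TopologicalSpace X]
    [AddCommGroup Y] [Module ℝ Y] [TopologicalSpace Y] (f : X → Y) : Prop :=
  ∃ d : (k : ℕ) → X → (Fin k → X) → Y,
    (∀ x v, d 0 x v = f x) ∧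
    (∀ k, Continuous fun p : X × (Fin k → X) => d k p.1 p.2) ∧
    ∀ (k : ℕ) (x : X) (v : Fin k → X) (w : X),
      Filter.Tendsto (fun s : ℝ => s⁻¹ • (d k (x + s • w) v - d k x v)) (𝓝[≠] 0)
        (𝓝 (d (k + 1) x (Fin.snoc (α := fun _ => X) v w)))

end Curves

/-! ### Lie groups: adjoint action, evolution, the twist `Ψ` -/

section Group

variable {E : Type*} [NormedAddCommGroup E] [NormedSpace ℝ E]
  {G : Type*} [TopologicalSpace G] [ChartedSpace E G] [Group G]

/-- The adjoint action `Ad(g) = T_e (x ↦ g x g⁻¹) : 𝔤 → 𝔤`. -/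
def Ad (g : G) : E →L[ℝ] E :=
  mfderiv 𝓘(ℝ, E) 𝓘(ℝ, E) (fun x : G => g * x * g⁻¹) 1

theorem contMDiff_Ad [LieGroup 𝓘(ℝ, E) ∞ G] :
    ContMDiff 𝓘(ℝ, E) 𝓘(ℝ, E →L[ℝ] E) ∞ (Ad : G → E →L[ℝ] E) := by
  have : IsManifold 𝓘(ℝ, E) 1 G := IsManifold.of_le (n := ∞) (by simp)
  intro g₀
  have hf : ContMDiff (𝓘(ℝ, E).prod 𝓘(ℝ, E)) 𝓘(ℝ, E) ∞
      (Function.uncurry fun (g x : G) => g * x * g⁻¹) :=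
    (contMDiff_fst.mul contMDiff_snd).mul (contMDiff_fst.inv)
  have h := ContMDiffAt.mfderiv (I := 𝓘(ℝ, E)) (I' := 𝓘(ℝ, E)) (J := 𝓘(ℝ, E)) (n := ∞) (m := ∞)
    (x₀ := g₀)
    (fun (g x : G) => g * x * g⁻¹) (fun _ => (1 : G)) hf.contMDiffAt contMDiffAt_const (by simp)
  refine h.congr_of_eventuallyEq (Filter.Eventually.of_forall fun g => ?_)
  have e : ∀ x : G, x * 1 * x⁻¹ = 1 := fun x => by simp
  have key := inTangentCoordinates_eq (I := 𝓘(ℝ, E)) (I' := 𝓘(ℝ, E)) (fun _ : G => (1 : G))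
    (fun x : G => x * 1 * x⁻¹) (Ad : G → E →L[ℝ] E) (x₀ := g₀) (x := g)
    (mem_chart_source E _) (by simp only [e]; exact mem_chart_source E _)
  refine Eq.trans ?_ key.symm
  simp only [e]
  ext v
  simp only [ContinuousLinearMap.comp_apply]
  rw [(tangentBundleCore 𝓘(ℝ, E) G).coordChange_self _ _ (mem_achart_source E 1),
    (tangentBundleCore 𝓘(ℝ, E) G).coordChange_self _ _ (mem_achart_source E 1)]

/-- `g = Evol(q)` solves `ġ(t) = T_e R_{g(t)} (q(t))`, `g(0) = e`. -/
def IsEvolution (q : SmoothCurve E E) (g : SmoothCurve E G) : Prop :=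
  g 0 = 1 ∧ ∀ t, velocity (F := E) g t
    = (mfderiv 𝓘(ℝ, E) 𝓘(ℝ, E) (fun x : G => x * g t) 1 : E →L[ℝ] E) (q t)

open Classical in
/-- The evolution operator `Evol : C^∞(I, 𝔤) → C^∞(I, G)`: the solution of the initial value
problem `IsEvolution`, which exists and is unique for every `q`. -/
def Evol (q : SmoothCurve E E) : SmoothCurve E G :=
  if h : ∃ g : SmoothCurve E G, IsEvolution q g then h.choose else ContMDiffMap.const 1

/-- `Ψ_{g₀}(q) = - Ad(g₀ Evol(q)⁻¹) . q`, pointwise in `t`. -/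
def Psi [LieGroup 𝓘(ℝ, E) ∞ G] (g₀ : G) (q : SmoothCurve E E) : SmoothCurve E E :=
  ⟨fun t => -(Ad (g₀ * (Evol q t : G)⁻¹) (q t)), by
    have h1 : ContMDiff (𝓡∂ 1) 𝓘(ℝ, E) ∞ fun t => g₀ * (Evol q t : G)⁻¹ :=
      contMDiff_const.mul (Evol q : SmoothCurve E G).contMDiff.inv
    exact ((contMDiff_Ad.comp h1).clm_apply q.contMDiff).neg⟩

/-- The Lie algebra `𝔥 ⊆ 𝔤` of a closed subgroup `H`: the velocities `γ'(0)` of the smooth curves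
`γ` in `G` with values in `H` and `γ(0) = e`. -/
def lieAlgebraOf [LieGroup 𝓘(ℝ, E) ∞ G] (H : Subgroup G) : Submodule ℝ E where
  carrier := {x | ∃ γ : ℝ → G, ContMDiff 𝓘(ℝ, ℝ) 𝓘(ℝ, E) ∞ γ ∧ (∀ s, γ s ∈ H) ∧ γ 0 = 1 ∧
    (mfderiv 𝓘(ℝ, ℝ) 𝓘(ℝ, E) γ 0 : ℝ →L[ℝ] E) 1 = x}
  zero_mem' := by
    refine ⟨fun _ => 1, contMDiff_const, fun _ => H.one_mem, rfl, ?_⟩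
    rw [mfderiv_const]; rfl
  add_mem' := by
    rintro _ _ ⟨γ, hγ, hγH, hγ0, rfl⟩ ⟨δ, hδ, hδH, hδ0, rfl⟩
    refine ⟨fun s => γ s * δ s, hγ.mul hδ, fun s => H.mul_mem (hγH s) (hδH s),
      by simp [hγ0, hδ0], ?_⟩
    have dγ := (hγ.mdifferentiable (by simp) 0).hasMFDerivAt
    have dδ := (hδ.mdifferentiable (by simp) 0).hasMFDerivAt
    have hm : MDifferentiableAt (𝓘(ℝ, E).prod 𝓘(ℝ, E)) 𝓘(ℝ, E) (fun p : G × G => p.1 * p.2)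
        (γ 0, δ 0) := (contMDiff_mul 𝓘(ℝ, E) ∞).mdifferentiable (by simp) _
    have h := hm.hasMFDerivAt.comp (0 : ℝ) (dγ.prodMk dδ)
    have h' := h.mfderiv
    rw [mfderiv_prod_eq_add hm] at h'
    have h1 : (fun z : G × G => z.1 * (γ 0, δ 0).2) = fun z => z.1 := by
      funext z; simp [hδ0]
    have h2 : (fun z : G × G => (γ 0, δ 0).1 * z.2) = fun z => z.2 := by
      funext z; simp [hγ0]
    erw [h1, h2, mfderiv_fst, mfderiv_snd] at h'
    exact congrArg (fun L : ℝ →L[ℝ] E => L 1) h'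
  smul_mem' := by
    rintro a _ ⟨γ, hγ, hγH, hγ0, rfl⟩
    have ha : ContMDiff 𝓘(ℝ, ℝ) 𝓘(ℝ, ℝ) ∞ fun s : ℝ => a * s :=
      (contDiff_const.mul contDiff_id).contMDiff
    refine ⟨fun s => γ (a * s), hγ.comp ha, fun s => hγH _, by simp [hγ0], ?_⟩
    have h1 : HasMFDerivAt 𝓘(ℝ, ℝ) 𝓘(ℝ, ℝ) (fun s : ℝ => a * s) 0
        (a • ContinuousLinearMap.id ℝ ℝ) :=
      ((hasFDerivAt_id (0 : ℝ)).const_mul a).hasMFDerivAt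
    have h2 : HasMFDerivAt 𝓘(ℝ, ℝ) 𝓘(ℝ, E) γ (a * 0) (mfderiv 𝓘(ℝ, ℝ) 𝓘(ℝ, E) γ (a * 0)) :=
      (hγ.mdifferentiable (by simp) _).hasMFDerivAt
    have h3 := (h2.comp (0 : ℝ) h1).mfderiv
    have h4 := congrArg (fun L : ℝ →L[ℝ] E => L 1) h3
    refine h4.trans ?_
    have h5 : (mfderiv 𝓘(ℝ, ℝ) 𝓘(ℝ, E) γ (a * 0) : ℝ →L[ℝ] E)
      = mfderiv 𝓘(ℝ, ℝ) 𝓘(ℝ, E) γ 0 := by rw [mul_zero]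
    change (mfderiv 𝓘(ℝ, ℝ) 𝓘(ℝ, E) γ (a * 0) : ℝ →L[ℝ] E) (a • (1 : ℝ)) = _
    rw [h5]
    exact map_smul (mfderiv 𝓘(ℝ, ℝ) 𝓘(ℝ, E) γ 0 : ℝ →L[ℝ] E) a 1

end Group

/-! ### The homogeneous space `G ⧸ H` -/

section Homogeneous

variable {E : Type*} [NormedAddCommGroup E] [NormedSpace ℝ E]
  {G : Type*} [TopologicalSpace G] [ChartedSpace E G] [Group G]
  {F : Type*} [NormedAddCommGroup F] [NormedSpace ℝ F]
  {H : Subgroup G} [ChartedSpace F (G ⧸ H)]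

/-- `𝔪` is a reductive complement of `𝔥` in `𝔤`: `𝔤 = 𝔥 ⊕ 𝔪` and `Ad(h) 𝔪 ⊆ 𝔪` for `h ∈ H`. -/
def IsReductiveComplement [LieGroup 𝓘(ℝ, E) ∞ G] (H : Subgroup G) (𝔪 : Submodule ℝ E) : Prop :=
  IsCompl (lieAlgebraOf H) 𝔪 ∧ ∀ h ∈ H, ∀ x ∈ 𝔪, Ad h x ∈ 𝔪

/-- The tangent map `T_e π : 𝔤 → T_{eH}(G ⧸ H)` of the projection `π : G → G ⧸ H`. -/
def tangentProj (E F : Type*) [NormedAddCommGroup E] [NormedSpace ℝ E]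
    [NormedAddCommGroup F] [NormedSpace ℝ F]
    {G : Type*} [TopologicalSpace G] [ChartedSpace E G] [Group G]
    (H : Subgroup G) [ChartedSpace F (G ⧸ H)] : E →L[ℝ] F :=
  mfderiv 𝓘(ℝ, E) 𝓘(ℝ, F) (QuotientGroup.mk : G → G ⧸ H) 1

/-- `ω_e : T_{eH}(G ⧸ H) → 𝔪 ⊆ 𝔤`, the inverse of `T_e π` restricted to `𝔪`. -/
def omegaE (H : Subgroup G) [ChartedSpace F (G ⧸ H)] (𝔪 : Submodule ℝ E) : F →L[ℝ] E :=
  𝔪.subtypeL ∘L (tangentProj E F H ∘L 𝔪.subtypeL).inverse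

/-- For `v` tangent to `G ⧸ H` at `x`, the vector `Ad(g) . ω_e (T Λ^{g⁻¹} v)`, where
`Λ^g : y ↦ g • y`; it is meant for `g` with `gH = x`. -/
def omegaAt (𝔪 : Submodule ℝ E) (g : G) (x : G ⧸ H) (v : TangentSpace 𝓘(ℝ, F) x) : E :=
  Ad g (omegaE (F := F) H 𝔪
    ((mfderiv 𝓘(ℝ, F) 𝓘(ℝ, F) (fun y : G ⧸ H => g⁻¹ • y) x : F →L[ℝ] F) v))

/-- The `𝔤`-valued 1-form `ω` on `G ⧸ H`, `ω(v) = Ad(g) . ω_e (T Λ^{g⁻¹} v)` for `v` tangent at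
`gH`; it does not depend on the representative `g`. -/
def omega (𝔪 : Submodule ℝ E) (x : G ⧸ H) (v : TangentSpace 𝓘(ℝ, F) x) : E :=
  omegaAt 𝔪 x.out x v

/-- `θ_ω(ċ) = ω ∘ ċ` for a curve `c : I → G ⧸ H`. -/
def thetaD (𝔪 : Submodule ℝ E) (c : SmoothCurve F (G ⧸ H)) : unitInterval → E :=
  fun t => omega 𝔪 (c t) (velocity (F := F) c t)

/-- `ρ_{c₀}(q) = Evol(q) . c₀`, a smooth curve in `G ⧸ H`; `π : G → G ⧸ H` is a submersion. -/
def rho [LieGroup 𝓘(ℝ, E) ∞ G]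
    (hπ : Manifold.IsSubmersion 𝓘(ℝ, E) 𝓘(ℝ, F) ∞ (QuotientGroup.mk : G → G ⧸ H))
    (c₀ : G ⧸ H) (q : SmoothCurve E E) : SmoothCurve F (G ⧸ H) :=
  ⟨fun t => (Evol q t : G) • c₀, by
    obtain ⟨g₀, rfl⟩ := QuotientGroup.mk_surjective c₀
    exact hπ.contMDiff.comp ((Evol q : SmoothCurve E G).contMDiff.mul contMDiff_const)⟩

end Homogeneous

end ReductiveSRVT

end

open ReductiveSRVT

/-! Everything rests on the right logarithmic derivative: a curve `c` in `G` has logarithmic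
derivative `q` when `ċ = T_e R_c (q)`. It satisfies the product rule `δ(cd) = δc + Ad(c) δd`, hence
`δ(c⁻¹) = -Ad(c⁻¹) δc`. If two curves have the same logarithmic derivative, `c⁻¹ d` has velocity
zero and is constant; this gives uniqueness of `Evol(q)`. For existence, a chart at `e` yields
solutions on time steps of a length independent of the starting time, which are glued by right
translations.

By the product rule `g₀ Evol(q)⁻¹ g₀⁻¹` starts at `e` and has logarithmic derivative `Ψ_{g₀}(q)`, so
it equals `Evol(Ψ_{g₀}(q))` (`evol_Psi`). Substituting this into the definition of `Ψ` shows that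
`Ψ_{g₀⁻¹}` inverts `Ψ_{g₀}`.

On `G ⧸ H`, the kernel of `T_e π` is `𝔥`, so `T_e π` restricts to an isomorphism on `𝔪`. If `g`
represents `x`, every tangent vector at `x` is the value at `x` of the fundamental vector field of
some `Ad(g) m` with `m ∈ 𝔪`, and `ω` recovers `Ad(g) m`. Independence of `g` is the
`Ad(H)`-invariance of `𝔪`. Now `k = g₀ Evol(q)⁻¹` lifts the curve `ρ_{c₀}(Ψ_{g₀}(q))`, whose
velocity is induced by `Ψ_{g₀}(q) = Ad(k)(-q)`; for `𝔪`-valued `q` this gives `θ_ω ∘ D ∘ ρ ∘ Ψ = Ψ`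
(`thetaD_rho_Psi`). Conversely, with `f = θ_ω(ċ)` the curve `Evol(f)⁻¹ . c` has velocity zero, so `c
= Evol(f) . c₀`. Then `Evol(f) g₀` lifts `c`, and `Ψ_{g₀⁻¹}(f) = -Ad((Evol(f) g₀)⁻¹) f` is
`𝔪`-valued (`image_Psi_eq`).

For Bastiani smoothness, `Evol` itself is never differentiated as a map into curves in `G`: `Ψ`
depends on `Evol(q)` only through `Ad(Evol(q)⁻¹)`, which solves a linear equation in `End(𝔤)`.
Duhamel's formula (`AdEvolInv_sub`, `AdEvol_sub`) gives continuity in `q` and the directional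
derivatives, which are again built from the same curves by products and antiderivatives; induction
on the order finishes. -/

noncomputable section

namespace ReductiveSRVT

open Set

set_option linter.unusedSectionVars false

/-! ### Velocities of curves in manifolds, within subsets of the line -/

section Calculus

variable {F : Type*} [NormedAddCommGroup F] [NormedSpace ℝ F]
  {M : Type*} [TopologicalSpace M] [ChartedSpace F M]
  {F' : Type*} [NormedAddCommGroup F'] [NormedSpace ℝ F']
  {M' : Type*} [TopologicalSpace M'] [ChartedSpace F' M']
  {F'' : Type*} [NormedAddCommGroup F''] [NormedSpace ℝ F'']
  {M'' : Type*} [TopologicalSpace M''] [ChartedSpace F'' M'']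

/-- The tangent map at `x`, as a continuous linear map between the model spaces. -/
def tmap (f : M → M') (x : M) : F →L[ℝ] F' := mfderiv 𝓘(ℝ, F) 𝓘(ℝ, F') f x

abbrev MD (f : M → M') (x : M) : Prop := MDifferentiableAt 𝓘(ℝ, F) 𝓘(ℝ, F') f x

theorem tmap_comp {g : M' → M''} {f : M → M'} {x : M} (hg : MD (F := F') (F' := F'') g (f x))
    (hf : MD (F := F) (F' := F') f x) :
    (tmap (fun y => g (f y)) x : F →L[ℝ] F'') = (tmap g (f x) : F' →L[ℝ] F'') ∘L (tmap f x : F →L[ℝ] F') :=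
  mfderiv_comp x hg hf

theorem tmap_comp_apply {g : M' → M''} {f : M → M'} {x : M}
    (hg : MD (F := F') (F' := F'') g (f x)) (hf : MD (F := F) (F' := F') f x) (v : F) :
    (tmap (fun y => g (f y)) x : F →L[ℝ] F'') v
      = (tmap g (f x) : F' →L[ℝ] F'') ((tmap f x : F →L[ℝ] F') v) := by
  rw [tmap_comp hg hf]; rfl

theorem tmap_id (x : M) : (tmap (fun y : M => y) x : F →L[ℝ] F) = ContinuousLinearMap.id ℝ F :=
  mfderiv_id

theorem tmap_congr {f g : M → M'} {x : M} (h : f =ᶠ[𝓝 x] g) :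
    (tmap f x : F →L[ℝ] F') = tmap g x :=
  h.mfderiv_eq

/-- The linear map `r ↦ r • v`. -/
def lineMap (F : Type*) [NormedAddCommGroup F] [NormedSpace ℝ F] (v : F) : ℝ →L[ℝ] F := ContinuousLinearMap.toSpanSingleton ℝ v

theorem lineMap_one (v : F) : lineMap F v 1 = v := by simp [lineMap]

theorem eq_lineMap {L : ℝ →L[ℝ] F} {v : F} (h : L 1 = v) : L = lineMap F v := by
  ext; simp [lineMap, h]

/-- The curve `c` has velocity `v` at `t`, within `s`. -/
def HasVel (c : ℝ → M) (s : Set ℝ) (t : ℝ) (v : F) : Prop :=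
  HasMFDerivWithinAt 𝓘(ℝ, ℝ) 𝓘(ℝ, F) c s t (lineMap F v)

variable {c : ℝ → M} {d : ℝ → M'} {s : Set ℝ} {t : ℝ} {v : F} {w : F'}

theorem HasVel.continuousWithinAt (h : HasVel c s t v) : ContinuousWithinAt c s t :=
  HasMFDerivWithinAt.continuousWithinAt h

theorem HasVel.mono {s' : Set ℝ} (h : HasVel c s t v) (hs : s' ⊆ s) : HasVel c s' t v :=
  HasMFDerivWithinAt.mono h hs

theorem HasVel.mono_nhds {s' : Set ℝ} (h : HasVel c s t v) (hs : s ∈ 𝓝[s'] t) :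
    HasVel c s' t v :=
  HasMFDerivWithinAt.mono_of_mem_nhdsWithin h hs

theorem HasVel.union {s' : Set ℝ} (h : HasVel c s t v) (h' : HasVel c s' t v) :
    HasVel c (s ∪ s') t v :=
  HasMFDerivWithinAt.union h h'

theorem HasVel.congr {c' : ℝ → M} (h : HasVel c s t v) (hs : ∀ y ∈ s, c' y = c y)
    (ht : c' t = c t) : HasVel c' s t v :=
  HasMFDerivWithinAt.congr_mono (I := 𝓘(ℝ, ℝ)) (I' := 𝓘(ℝ, F)) (f' := lineMap F v) h hs ht
    subset_rfl

theorem HasVel.unique {v' : F} (hs : UniqueDiffWithinAt ℝ s t) (h : HasVel c s t v)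
    (h' : HasVel c s t v') : v = v' := by
  have : lineMap F v = lineMap F v' := hs.uniqueMDiffWithinAt.eq h h'
  rw [← lineMap_one v, this, lineMap_one]

theorem hasVel_of_hasMFDerivWithinAt {L : ℝ →L[ℝ] F}
    (h : HasMFDerivWithinAt 𝓘(ℝ, ℝ) 𝓘(ℝ, F) c s t L) {v : F} (hL : L 1 = v) :
    HasVel c s t v :=
  HasMFDerivWithinAt.congr_mfderiv h (eq_lineMap hL)

theorem hasVel_of_mdifferentiableWithinAt
    (h : MDifferentiableWithinAt 𝓘(ℝ, ℝ) 𝓘(ℝ, F) c s t) :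
    HasVel (F := F) c s t ((mfderivWithin 𝓘(ℝ, ℝ) 𝓘(ℝ, F) c s t : ℝ →L[ℝ] F) 1) :=
  hasVel_of_hasMFDerivWithinAt (MDifferentiableWithinAt.hasMFDerivWithinAt h) rfl

theorem HasVel.mdifferentiableWithinAt (h : HasVel c s t v) :
    MDifferentiableWithinAt 𝓘(ℝ, ℝ) 𝓘(ℝ, F) c s t :=
  HasMFDerivWithinAt.mdifferentiableWithinAt h

theorem HasVel.comp {f : M → M'} (hf : MD (F := F) (F' := F') f (c t)) (h : HasVel c s t v) :
    HasVel (fun τ => f (c τ)) s t ((tmap f (c t) : F →L[ℝ] F') v) := by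
  refine hasVel_of_hasMFDerivWithinAt
    (MDifferentiableAt.hasMFDerivAt hf |>.comp_hasMFDerivWithinAt t h) ?_
  exact congrArg (tmap f (c t) : F →L[ℝ] F') (lineMap_one v)

theorem HasVel.comp₂ {f : M → M' → M''}
    (hf : MDifferentiableAt (𝓘(ℝ, F).prod 𝓘(ℝ, F')) 𝓘(ℝ, F'') (fun p : M × M' => f p.1 p.2)
      (c t, d t))
    (h : HasVel c s t v) (h' : HasVel d s t w) :
    HasVel (fun τ => f (c τ) (d τ)) s t
      ((tmap (fun x => f x (d t)) (c t) : F →L[ℝ] F'') v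
        + (tmap (fun y => f (c t) y) (d t) : F' →L[ℝ] F'') w) := by
  refine hasVel_of_hasMFDerivWithinAt (hf.hasMFDerivAt.comp_hasMFDerivWithinAt t
    (HasMFDerivWithinAt.prodMk h h')) ?_
  have := mfderiv_prod_eq_add_apply (v := ((v, w) : F × F')) hf
  refine Eq.trans ?_ this
  exact congrArg (mfderiv (𝓘(ℝ, F).prod 𝓘(ℝ, F')) 𝓘(ℝ, F'') (fun p : M × M' => f p.1 p.2)
      (c t, d t) : F × F' →L[ℝ] F'') (Prod.ext (lineMap_one v) (lineMap_one w))

theorem hasVel_iff_hasDerivWithinAt {u : ℝ → F} : HasVel u s t v ↔ HasDerivWithinAt u v s t :=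
  hasMFDerivWithinAt_iff_hasFDerivWithinAt (f' := lineMap F v)

theorem hasVel_const (x : M) : HasVel (fun _ => x) s t (0 : F) :=
  hasVel_of_hasMFDerivWithinAt (L := 0)
    (hasMFDerivWithinAt_const (I := 𝓘(ℝ, ℝ)) (I' := 𝓘(ℝ, F)) x s t) rfl

/-- Bridge from the manifold with boundary `I` to derivatives within `[0,1] ⊆ ℝ`; all further
calculus of curves takes place on the real side. -/
theorem hasVel_extend {c : unitInterval → M} {t : unitInterval}
    (hc : MDifferentiableAt (𝓡∂ 1) 𝓘(ℝ, F) c t) :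
    HasVel (F := F) (IccExtend zero_le_one c) (Icc (0 : ℝ) 1) t (velocity (F := F) c t) := by
  have h1 : MDifferentiableWithinAt 𝓘(ℝ, ℝ) 𝓘(ℝ, F) (c ∘ projIcc (0:ℝ) 1 zero_le_one)
    (Icc 0 1) t := mdifferentiableWithinAt_comp_projIcc_iff.2 hc
  have := hasVel_of_mdifferentiableWithinAt h1
  have h2 := mfderivWithin_comp_projIcc_one (I := 𝓘(ℝ, F)) (f := c) (w := t)
  have h3 : ((mfderivWithin 𝓘(ℝ, ℝ) 𝓘(ℝ, F) (c ∘ projIcc (0:ℝ) 1 zero_le_one) (Icc 0 1) t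
    : ℝ →L[ℝ] F) 1) = velocity (F := F) c t := h2
  rw [h3] at this
  exact this

theorem uniqueDiffWithinAt_unit (t : unitInterval) :
    UniqueDiffWithinAt ℝ (Icc (0 : ℝ) 1) t :=
  uniqueDiffOn_Icc_zero_one _ t.2

theorem velocity_eq_of_hasVel {c : unitInterval → M} {t : unitInterval} {v : F}
    (h : HasVel (IccExtend zero_le_one c) (Icc (0 : ℝ) 1) t v) :
    velocity (F := F) c t = v := by
  have h1 : MDifferentiableAt (𝓡∂ 1) 𝓘(ℝ, F) c t :=
    mdifferentiableWithinAt_comp_projIcc_iff.1 (HasVel.mdifferentiableWithinAt h)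
  exact HasVel.unique (F := F) (uniqueDiffWithinAt_unit t) (hasVel_extend h1) h

theorem SmoothCurve.hasVel (c : SmoothCurve F M) (t : unitInterval) :
    HasVel (F := F) (IccExtend zero_le_one c) (Icc (0 : ℝ) 1) t (velocity (F := F) c t) :=
  hasVel_extend (c.contMDiff.mdifferentiable (by simp) t)

theorem contMDiff_iff_extend {c : unitInterval → M} :
    ContMDiff (𝓡∂ 1) 𝓘(ℝ, F) ∞ c ↔
      ContMDiffOn 𝓘(ℝ, ℝ) 𝓘(ℝ, F) ∞ (IccExtend zero_le_one c) (Icc (0 : ℝ) 1) :=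
  contMDiffOn_comp_projIcc_iff.symm

/-- A smooth curve from a map that is smooth on `[0,1]`. -/
def SmoothCurve.ofReal (c : ℝ → M) (hc : ContMDiffOn 𝓘(ℝ, ℝ) 𝓘(ℝ, F) ∞ c (Icc (0 : ℝ) 1)) :
    SmoothCurve F M :=
  ⟨fun t => c t, contMDiff_iff_extend.2 (hc.congr fun t ht => by
    simp [IccExtend, projIcc_of_mem zero_le_one ht])⟩

theorem extend_ofReal {α : Type*} {c : ℝ → α} {t : ℝ} (ht : t ∈ Icc (0 : ℝ) 1) :
    IccExtend zero_le_one (fun t : unitInterval => c t) t = c t := by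
  simp [IccExtend, projIcc_of_mem zero_le_one ht]

theorem velocity_eq_of_hasVel' {c : ℝ → M} {t : unitInterval} {v : F}
    (h : HasVel c (Icc (0 : ℝ) 1) t v) :
    velocity (F := F) (fun t : unitInterval => c t) t = v :=
  velocity_eq_of_hasVel (h.congr (fun _ hy => extend_ofReal hy) (extend_ofReal t.2))

/-- A curve with vanishing velocity is constant. -/
theorem eq_of_hasVel_zero [IsManifold 𝓘(ℝ, F) 1 M] {c : ℝ → M}
    (h : ∀ t ∈ Icc (0 : ℝ) 1, HasVel c (Icc (0 : ℝ) 1) t (0 : F)) {t : ℝ}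
    (ht : t ∈ Icc (0 : ℝ) 1) : c t = c 0 := by
  have hcont : ContinuousOn c (Icc 0 1) := fun t ht => (h t ht).continuousWithinAt
  have hlc : IsLocallyConstant (fun t : unitInterval => c t) := by
    rw [IsLocallyConstant.iff_eventually_eq]
    intro t
    have hsrc : (chartAt F (c t)).source ∈ 𝓝 (c t) :=
      (chartAt F (c t)).open_source.mem_nhds (mem_chart_source F _)
    have h1 : c ⁻¹' (chartAt F (c t)).source ∈ 𝓝[Icc 0 1] (t : ℝ) := hcont t t.2 hsrc
    obtain ⟨ε, hε, hb⟩ := Metric.mem_nhdsWithin_iff.1 h1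
    set S := Metric.ball (t : ℝ) ε ∩ Icc 0 1 with hS
    have hconv : Convex ℝ S := (convex_ball _ _).inter (convex_Icc 0 1)
    have hmd : ∀ y ∈ S, HasDerivWithinAt (fun τ => extChartAt 𝓘(ℝ, F) (c t) (c τ)) 0 S y := by
      intro y hy
      rw [← hasVel_iff_hasDerivWithinAt]
      have h2 : MD (F := F) (F' := F) (extChartAt 𝓘(ℝ, F) (c t)) (c y) :=
        mdifferentiableAt_extChartAt (hb hy)
      have := HasVel.comp h2 ((h y hy.2).mono (s' := S) inter_subset_right)
      rwa [map_zero] at this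
    have hev : ∀ᶠ y : unitInterval in 𝓝 t, (y : ℝ) ∈ Metric.ball (t : ℝ) ε :=
      continuous_subtype_val.continuousAt (Metric.ball_mem_nhds _ hε)
    filter_upwards [hev] with y hy
    have hyS : (y : ℝ) ∈ S := ⟨hy, y.2⟩
    have htS : (t : ℝ) ∈ S := ⟨Metric.mem_ball_self hε, t.2⟩
    have h3 := hconv.is_const_of_fderivWithin_eq_zero (𝕜 := ℝ)
      (fun z hz => (hmd z hz).differentiableWithinAt) (fun z hz => by
        have h4 := (hmd z hz).hasFDerivWithinAt
        -- `fderivWithin` also takes the value zero where derivatives are not unique, so unique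
        -- differentiability of `S` need not be proved.
        by_cases hu : UniqueDiffWithinAt ℝ S z
        · rw [h4.fderivWithin hu]; ext; simp
        · exact fderivWithin_zero_of_not_uniqueDiffWithinAt hu) hyS htS
    refine (extChartAt 𝓘(ℝ, F) (c t)).injOn ?_ ?_ h3
    · rw [extChartAt_source]; exact hb hyS
    · rw [extChartAt_source]; exact hb htS
  exact hlc.apply_eq_of_preconnectedSpace ⟨t, ht⟩ 0

end Calculus

/-! ### Right logarithmic derivatives and uniqueness of evolutions -/

section LieCalculus

variable {E : Type*} [NormedAddCommGroup E] [NormedSpace ℝ E]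
  {G : Type*} [TopologicalSpace G] [ChartedSpace E G] [Group G] [LieGroup 𝓘(ℝ, E) ∞ G]

theorem isManifold_one_of_lieGroup (E G : Type*) [NormedAddCommGroup E] [NormedSpace ℝ E]
    [TopologicalSpace G] [ChartedSpace E G] [Group G] [LieGroup 𝓘(ℝ, E) ∞ G] :
    IsManifold 𝓘(ℝ, E) 1 G := IsManifold.of_le (n := ∞) (by simp)

theorem contMDiff_mul_right' (a : G) : ContMDiff 𝓘(ℝ, E) 𝓘(ℝ, E) ∞ fun x : G => x * a :=
  contMDiff_id.mul contMDiff_const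

theorem contMDiff_mul_left' (a : G) : ContMDiff 𝓘(ℝ, E) 𝓘(ℝ, E) ∞ fun x : G => a * x :=
  contMDiff_const.mul contMDiff_id

theorem md_mul_right (a g : G) : MD (F := E) (F' := E) (fun x : G => x * a) g :=
  (contMDiff_mul_right' a).mdifferentiable (by simp) g

theorem md_mul_left (a g : G) : MD (F := E) (F' := E) (fun x : G => a * x) g :=
  (contMDiff_mul_left' a).mdifferentiable (by simp) g

theorem md_conj (a g : G) : MD (F := E) (F' := E) (fun x : G => a * x * a⁻¹) g :=
  ((contMDiff_mul_right' a⁻¹).comp (contMDiff_mul_left' a)).mdifferentiable (by simp) g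

/-- The tangent map `T_e R_g` of the right translation by `g`. -/
def rightT (E : Type*) [NormedAddCommGroup E] [NormedSpace ℝ E]
    {G : Type*} [TopologicalSpace G] [ChartedSpace E G] [Group G] (g : G) : E →L[ℝ] E :=
  tmap (fun x : G => x * g) 1

theorem tmap_mul_right_rightT (g h : G) (v : E) :
    (tmap (fun x : G => x * h) g : E →L[ℝ] E) (rightT E g v) = rightT E (g * h) v := by
  have h1 := tmap_comp_apply (F := E) (F' := E) (F'' := E) (g := fun x : G => x * h)
    (f := fun x : G => x * g) (x := 1) (md_mul_right h _) (md_mul_right g _) v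
  simp only [mul_assoc, one_mul] at h1
  exact h1.symm

/-- Differentiate `a (x g) = (a x a⁻¹)(a g)` at `x = e`. In the right trivialisation left
translations act by `Ad`, while right translations act trivially. -/
theorem tmap_mul_left_rightT (a g : G) (v : E) :
    (tmap (fun x : G => a * x) g : E →L[ℝ] E) (rightT E g v) = rightT E (a * g) (Ad a v) := by
  have h1 := tmap_comp_apply (F := E) (F' := E) (F'' := E) (g := fun x : G => a * x)
    (f := fun x : G => x * g) (x := 1) (md_mul_left a _) (md_mul_right g _) v
  have h2 := tmap_comp_apply (F := E) (F' := E) (F'' := E) (g := fun x : G => x * (a * g))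
    (f := fun x : G => a * x * a⁻¹) (x := 1) (md_mul_right _ _) (md_conj a _) v
  have e : (fun y : G => a * y * a⁻¹ * (a * g)) = fun y => a * (y * g) := by
    funext y; group
  rw [e, h1, one_mul] at h2
  simp only [mul_one, mul_inv_cancel] at h2
  exact h2

theorem rightT_one : rightT E (1 : G) = ContinuousLinearMap.id ℝ E := by
  simp only [rightT, mul_one]
  exact tmap_id _

theorem tmap_inv_rightT (g : G) (v : E) :
    (tmap (fun x : G => x * g⁻¹) g : E →L[ℝ] E) (rightT E g v) = v := by
  rw [tmap_mul_right_rightT, mul_inv_cancel, rightT_one]; rfl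

theorem rightT_tmap_inv (g : G) (v : E) :
    rightT E g ((tmap (fun x : G => x * g⁻¹) g : E →L[ℝ] E) v) = v := by
  have h1 := tmap_comp_apply (F := E) (F' := E) (F'' := E) (g := fun x : G => x * g)
    (f := fun x : G => x * g⁻¹) (x := g) (md_mul_right g _) (md_mul_right g⁻¹ _) v
  simp only [inv_mul_cancel_right, mul_inv_cancel] at h1
  rw [tmap_id] at h1
  exact h1.symm

theorem rightT_injective (g : G) : Function.Injective (rightT E g) :=
  Function.LeftInverse.injective (tmap_inv_rightT g)

theorem Ad_one : (Ad (1 : G) : E →L[ℝ] E) = ContinuousLinearMap.id ℝ E := by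
  have : (fun x : G => 1 * x * 1⁻¹) = fun x => x := by funext x; simp
  change tmap (fun x : G => 1 * x * 1⁻¹) 1 = _
  rw [this]; exact tmap_id _

theorem Ad_mul (g h : G) : (Ad (g * h) : E →L[ℝ] E) = Ad g ∘L Ad h := by
  have h2 := tmap_comp (F := E) (F' := E) (F'' := E) (g := fun x : G => g * x * g⁻¹)
    (f := fun x : G => h * x * h⁻¹) (x := 1) (md_conj g _) (md_conj h _)
  have e : (fun y : G => g * (h * y * h⁻¹) * g⁻¹) = fun y => (g * h) * y * (g * h)⁻¹ := by
    funext y; group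
  rw [e] at h2
  simp only [mul_one, mul_inv_cancel] at h2
  exact h2

theorem Ad_mul_apply (g h : G) (v : E) : (Ad (g * h) : E →L[ℝ] E) v = Ad g (Ad h v) := by
  rw [Ad_mul]; rfl

theorem Ad_inv_apply_Ad (g : G) (v : E) : Ad g⁻¹ (Ad g v) = v := by
  rw [← Ad_mul_apply, inv_mul_cancel, Ad_one]; rfl

theorem Ad_apply_Ad_inv (g : G) (v : E) : Ad g (Ad g⁻¹ v) = v := by
  rw [← Ad_mul_apply, mul_inv_cancel, Ad_one]; rfl

/-- The curve `c` has right logarithmic derivative `q` at `t`, within `s`. -/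
def HasLogDeriv (c : ℝ → G) (s : Set ℝ) (t : ℝ) (q : E) : Prop :=
  HasVel c s t (rightT E (c t) q)

variable {c d : ℝ → G} {s : Set ℝ} {t : ℝ} {q p : E}

theorem HasVel.hasLogDeriv {v : E} (h : HasVel c s t v) :
    HasLogDeriv c s t ((tmap (fun x : G => x * (c t)⁻¹) (c t) : E →L[ℝ] E) v) := by
  rw [HasLogDeriv, rightT_tmap_inv]; exact h

theorem HasLogDeriv.unique (hs : UniqueDiffWithinAt ℝ s t) (h : HasLogDeriv c s t q)
    (h' : HasLogDeriv c s t p) : q = p :=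
  rightT_injective (c t) (HasVel.unique hs h h')

theorem hasLogDeriv_const (g : G) : HasLogDeriv (fun _ => g) s t (0 : E) := by
  rw [HasLogDeriv, map_zero]; exact hasVel_const g

/-- The partial tangent maps of the multiplication are a right translation, which keeps `q`, and a
left translation, which turns `p` into `Ad (c t) p`. -/
theorem HasLogDeriv.mul (hc : HasLogDeriv c s t q) (hd : HasLogDeriv d s t p) :
    HasLogDeriv (fun τ => c τ * d τ) s t (q + Ad (c t) p) := by
  have h := HasVel.comp₂ (f := fun x y : G => x * y) (F'' := E)
    ((contMDiff_mul 𝓘(ℝ, E) ∞).mdifferentiable (by simp) _) hc hd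
  rw [tmap_mul_right_rightT, tmap_mul_left_rightT, ← map_add] at h
  exact h

/-- Some logarithmic derivative exists because inversion is differentiable; its value is then solved
for from the product rule applied to the constant curve `c c⁻¹`. -/
theorem HasLogDeriv.inv (hs : UniqueDiffWithinAt ℝ s t) (hc : HasLogDeriv c s t q) :
    HasLogDeriv (fun τ => (c τ)⁻¹) s t (-(Ad (c t)⁻¹ q)) := by
  have hi := (HasVel.comp (f := fun x : G => x⁻¹) (F' := E)
    ((contMDiff_inv 𝓘(ℝ, E) ∞).mdifferentiable (by simp) _) hc).hasLogDeriv
  have h1 := hc.mul hi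
  have h2 : HasLogDeriv (fun τ => c τ * (c τ)⁻¹) s t (0 : E) := by
    simp only [mul_inv_cancel]; exact hasLogDeriv_const 1
  have h3 := h1.unique hs h2
  have h4 := congrArg (Ad (E := E) (c t)⁻¹) h3
  rw [map_add, Ad_inv_apply_Ad, map_zero] at h4
  rwa [eq_neg_of_add_eq_zero_right h4] at hi

variable (E G) in
/-- The adjoint representation `ad = T_e Ad` of the Lie algebra. -/
def ad : E →L[ℝ] E →L[ℝ] E := tmap (Ad : G → E →L[ℝ] E) 1

/-- Since `Ad (x * c t) = Ad x ∘ Ad (c t)`, the derivative at `x = e` in direction `q` is `ad q ∘ Ad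
(c t)`. This is the linear equation behind the smoothness of `Ψ`. -/
theorem HasLogDeriv.hasDerivWithinAt_Ad (hc : HasLogDeriv c s t q) :
    HasDerivWithinAt (fun τ => (Ad (c τ) : E →L[ℝ] E)) (ad E G q ∘L Ad (c t)) s t := by
  have hmd : ∀ g : G, MD (F := E) (F' := E →L[ℝ] E) (Ad : G → E →L[ℝ] E) g :=
    contMDiff_Ad.mdifferentiable (by simp)
  have h1 := HasVel.comp (hmd _) hc
  rw [hasVel_iff_hasDerivWithinAt] at h1
  refine h1.congr_deriv ?_
  have h2 := tmap_comp_apply (F := E) (F' := E) (F'' := E →L[ℝ] E) (g := (Ad : G → E →L[ℝ] E))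
    (f := fun x : G => x * c t) (x := 1) (hmd _) (md_mul_right _ _) q
  set K : (E →L[ℝ] E) →L[ℝ] (E →L[ℝ] E) :=
    (ContinuousLinearMap.compL ℝ E E E).flip (Ad (c t)) with hK
  have h3 := tmap_comp_apply (F := E) (F' := E →L[ℝ] E) (F'' := E →L[ℝ] E) (g := K)
    (f := (Ad : G → E →L[ℝ] E)) (x := 1) K.differentiableAt.mdifferentiableAt (hmd _) q
  have e : (fun y : G => K (Ad y)) = fun y => Ad (y * c t) := by
    funext y; rw [Ad_mul]; rfl
  have e2 : (tmap K (Ad (1 : G)) : (E →L[ℝ] E) →L[ℝ] (E →L[ℝ] E)) = K := K.mfderiv_eq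
  rw [e, h2, e2, one_mul] at h3
  exact h3

theorem HasLogDeriv.comp_const_mul (g : G) (hc : HasLogDeriv c s t q) :
    HasLogDeriv (fun τ => g * c τ) s t (Ad g q) := by
  have := (hasLogDeriv_const (s := s) (t := t) (E := E) g).mul hc
  rwa [zero_add] at this

theorem HasLogDeriv.comp_mul_const (g : G) (hc : HasLogDeriv c s t q) :
    HasLogDeriv (fun τ => c τ * g) s t q := by
  have := hc.mul (hasLogDeriv_const (s := s) (t := t) (E := E) g)
  rwa [map_zero, add_zero] at this

/-- The curve `c⁻¹ d` has logarithmic derivative `-Ad(c⁻¹) q + Ad(c⁻¹) q = 0`, so it is constant; no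
Grönwall estimate is needed. -/
theorem eq_of_hasLogDeriv {c d : ℝ → G} {q : ℝ → E}
    (hc : ∀ t ∈ Icc (0 : ℝ) 1, HasLogDeriv c (Icc (0 : ℝ) 1) t (q t))
    (hd : ∀ t ∈ Icc (0 : ℝ) 1, HasLogDeriv d (Icc (0 : ℝ) 1) t (q t)) (h0 : c 0 = d 0)
    {t : ℝ} (ht : t ∈ Icc (0 : ℝ) 1) : c t = d t := by
  have := isManifold_one_of_lieGroup E G
  have h1 : ∀ t ∈ Icc (0 : ℝ) 1, HasVel (F := E) (fun τ => (c τ)⁻¹ * d τ) (Icc (0 : ℝ) 1) t 0 := by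
    intro t ht
    have := ((hc t ht).inv (uniqueDiffOn_Icc_zero_one t ht)).mul (hd t ht)
    rwa [neg_add_cancel, HasLogDeriv, map_zero] at this
  have h2 := eq_of_hasVel_zero h1 ht
  rw [h0, inv_mul_cancel, inv_mul_eq_one] at h2
  exact h2

/-! Curves on the unit interval -/

theorem isEvolution_iff (q : SmoothCurve E E) (g : SmoothCurve E G) :
    IsEvolution q g ↔ g 0 = 1 ∧ ∀ t : unitInterval,
      HasLogDeriv (IccExtend zero_le_one g) (Icc (0 : ℝ) 1) t (q t) := by
  refine and_congr_right fun _ => forall_congr' fun t => ?_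
  have h := SmoothCurve.hasVel g t
  have e : IccExtend zero_le_one g (t : ℝ) = g t := by simp [IccExtend]
  rw [HasLogDeriv, e]
  constructor
  · intro h1
    have h1' : velocity (F := E) g t = rightT E (g t) (q t) := h1
    rw [h1'] at h
    exact h
  · intro h1
    exact HasVel.unique (F := E) (uniqueDiffWithinAt_unit t) h h1

theorem IsEvolution.unique {q : SmoothCurve E E} {g g' : SmoothCurve E G}
    (h : IsEvolution q g) (h' : IsEvolution q g') : g = g' := by
  rw [isEvolution_iff] at h h'
  ext t
  have e : ∀ g : SmoothCurve E G, IccExtend zero_le_one g (t : ℝ) = g t := by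
    intro g; simp [IccExtend]
  rw [← e g, ← e g']
  refine eq_of_hasLogDeriv (q := IccExtend zero_le_one q) ?_ ?_ ?_ t.2
  · intro t ht; have := h.2 ⟨t, ht⟩; simpa [IccExtend, projIcc_of_mem zero_le_one ht] using this
  · intro t ht; have := h'.2 ⟨t, ht⟩; simpa [IccExtend, projIcc_of_mem zero_le_one ht] using this
  · have e0 : ∀ g : SmoothCurve E G, IccExtend zero_le_one g (0 : ℝ) = g 0 := by
      intro g; simp [IccExtend]
    rw [e0, e0, h.1, h'.1]

end LieCalculus

/-! ### Local solutions with a uniform existence time -/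

section LocalSolution

variable {E : Type*} [NormedAddCommGroup E] [NormedSpace ℝ E] [CompleteSpace E]

-- The Picard–Lindelöf solution is kept together with its confinement to the ball, which later
-- guarantees that it does not leave the chart.
open ODE in
theorem _root_.IsPicardLindelof.exists_mem_closedBall_hasDerivWithinAt {f : ℝ → E → E}
    {tmin tmax : ℝ} {t₀ : Icc tmin tmax} {x₀ x : E} {a r L K : NNReal}
    (hf : IsPicardLindelof f t₀ x₀ a r L K) (hx : x ∈ Metric.closedBall x₀ r) :
    ∃ α : ℝ → E, α t₀ = x ∧ ∀ t ∈ Icc tmin tmax, α t ∈ Metric.closedBall x₀ a ∧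
      HasDerivWithinAt α (f t (α t)) (Icc tmin tmax) t := by
  obtain ⟨α, hα⟩ := FunSpace.exists_isFixedPt_next hf hx
  refine ⟨α.compProj, by rw [FunSpace.compProj_val, ← hα, FunSpace.next_apply₀], fun t ht =>
    ⟨α.compProj_mem_closedBall hf.mul_max_le, ?_⟩⟩
  apply hasDerivWithinAt_picard_Icc t₀.2 hf.continuousOn_uncurry
    α.continuous_compProj.continuousOn (fun _ ht' => α.compProj_mem_closedBall hf.mul_max_le)
    x ht |>.congr_of_mem _ ht
  intro t' ht'
  nth_rw 1 [← hα]
  rw [FunSpace.compProj_of_mem ht', FunSpace.next_apply]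

/-- The field `A u (q t)` depends on time only through `q`, which is bounded on all of `ℝ`. The
Picard–Lindelöf constants, and with them `ε`, are therefore independent of `t₀`. -/
theorem exists_uniform_local_solution {A : E → E →L[ℝ] E} {u₀ : E} (hA : ContDiffAt ℝ 1 A u₀)
    {U : Set E} (hU : U ∈ 𝓝 u₀) {q : ℝ → E} (hq : Continuous q) {B : ℝ} (hB : ∀ t, ‖q t‖ ≤ B) :
    ∃ ε > 0, ∀ t₀ : ℝ, ∃ u : ℝ → E, u t₀ = u₀ ∧ ∀ t ∈ Icc t₀ (t₀ + ε), u t ∈ U ∧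
      HasDerivWithinAt u (A (u t) (q t)) (Icc t₀ (t₀ + ε)) t := by
  have hB0 : 0 ≤ B := (norm_nonneg _).trans (hB 0)
  obtain ⟨K, s, hs, hK⟩ := hA.exists_lipschitzOnWith
  have hbd : ∀ᶠ u in 𝓝 u₀, ‖A u‖ < ‖A u₀‖ + 1 :=
    hA.continuousAt.norm.eventually_lt continuousAt_const (by simp)
  obtain ⟨a, ha, hball⟩ := Metric.nhds_basis_closedBall.mem_iff.1
    (Filter.inter_mem (Filter.inter_mem hs hU) hbd)
  lift a to NNReal using ha.le
  lift B to NNReal using hB0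
  -- `L` bounds the field on the ball of radius `a`, so a solution with `L * ε ≤ a` stays in it; the
  -- `+ 1` in the denominator of `ε` covers `L = 0`.
  set L : NNReal := (‖A u₀‖₊ + 1) * B with hL
  set ε : ℝ := a / (L + 1) with hε
  have hε0 : 0 < ε := by positivity
  refine ⟨ε, hε0, fun t₀ => ?_⟩
  have hpl : IsPicardLindelof (fun t u => A u (q t)) (tmin := t₀) (tmax := t₀ + ε)
      ⟨t₀, by simp [hε0.le]⟩ u₀ a 0 L (K * B) := by
    refine ⟨fun t _ => ?_, fun x _ => ?_, fun t _ x hx => ?_, ?_⟩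
    · refine LipschitzOnWith.of_dist_le_mul fun x hx y hy => ?_
      have h1 := hK.dist_le_mul x (hball hx).1.1 y (hball hy).1.1
      rw [dist_eq_norm, ← sub_apply]
      rw [dist_eq_norm] at h1
      calc ‖(A x - A y) (q t)‖ ≤ ‖A x - A y‖ * ‖q t‖ := ContinuousLinearMap.le_opNorm _ _
        _ ≤ (K * dist x y) * B := by gcongr; exact hB t
        _ = _ := by push_cast; ring
    · exact ((A x).continuous.comp hq).continuousOn
    · calc ‖A x (q t)‖ ≤ ‖A x‖ * ‖q t‖ := ContinuousLinearMap.le_opNorm _ _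
        _ ≤ (‖A u₀‖ + 1) * B := by
          gcongr
          · exact (hball hx).2.le
          · exact hB t
        _ = L := by rw [hL]; push_cast; rfl
    · simp only [add_sub_cancel_left, sub_self, NNReal.coe_zero, sub_zero, max_eq_left hε0.le]
      rw [hε, mul_div_assoc', div_le_iff₀ (by positivity)]
      nlinarith [a.2, L.2]
  obtain ⟨u, hu, h⟩ := hpl.exists_mem_closedBall_hasDerivWithinAt
    (Metric.mem_closedBall_self le_rfl)
  exact ⟨u, hu, fun t ht => ⟨(hball (h t ht).1).1.2, (h t ht).2⟩⟩

end LocalSolution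

/-! ### Existence and smoothness of evolutions -/

section Evolution

variable {E : Type*} [NormedAddCommGroup E] [NormedSpace ℝ E]
  {G : Type*} [TopologicalSpace G] [ChartedSpace E G] [Group G] [LieGroup 𝓘(ℝ, E) ∞ G]

variable (E G) in
/-- The chart of `G` at the identity. -/
def unitChart : PartialEquiv G E := extChartAt 𝓘(ℝ, E) (1 : G)

theorem isOpen_unitChart_target : IsOpen (unitChart E G).target := isOpen_extChartAt_target 1

theorem isOpen_unitChart_source : IsOpen (unitChart E G).source := isOpen_extChartAt_source 1

theorem one_mem_unitChart_source : (1 : G) ∈ (unitChart E G).source := mem_extChartAt_source 1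

theorem contMDiffOn_unitChart :
    ContMDiffOn 𝓘(ℝ, E) 𝓘(ℝ, E) ∞ (unitChart E G) (unitChart E G).source := by
  have : IsManifold 𝓘(ℝ, E) ∞ G := inferInstance
  rw [unitChart, extChartAt_source]
  exact contMDiffOn_extChartAt

theorem contMDiffOn_unitChart_symm :
    ContMDiffOn 𝓘(ℝ, E) 𝓘(ℝ, E) ∞ (unitChart E G).symm (unitChart E G).target :=
  contMDiffOn_extChartAt_symm 1

theorem contMDiffAt_unitChart {g : G} (hg : g ∈ (unitChart E G).source) :
    ContMDiffAt 𝓘(ℝ, E) 𝓘(ℝ, E) ∞ (unitChart E G) g :=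
  contMDiffOn_unitChart.contMDiffAt (isOpen_unitChart_source.mem_nhds hg)

theorem contMDiffAt_unitChart_symm {u : E} (hu : u ∈ (unitChart E G).target) :
    ContMDiffAt 𝓘(ℝ, E) 𝓘(ℝ, E) ∞ (unitChart E G).symm u :=
  contMDiffOn_unitChart_symm.contMDiffAt (isOpen_unitChart_target.mem_nhds hu)

variable (E G) in
/-- The coefficient `u ↦ T_e (x ↦ φ (x φ⁻¹(u)))` of right invariant vector fields in the chart `φ`
at the identity. -/
def rightField (u : E) : E →L[ℝ] E :=
  tmap (fun x : G => unitChart E G (x * (unitChart E G).symm u)) 1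

theorem contDiffAt_rightField {u₀ : E} (hu₀ : u₀ ∈ (unitChart E G).target) :
    ContDiffAt ℝ ∞ (rightField E G) u₀ := by
  have := isManifold_one_of_lieGroup E G
  rw [← contMDiffAt_iff_contDiffAt]
  have hmem : (1 : G) * (unitChart E G).symm u₀ ∈ (unitChart E G).source := by
    rw [one_mul]; exact (unitChart E G).map_target hu₀
  have h0 : ContMDiffAt (𝓘(ℝ, E).prod 𝓘(ℝ, E)) 𝓘(ℝ, E) ∞
      (fun p : E × G => p.2 * (unitChart E G).symm p.1) (u₀, 1) :=
    contMDiffAt_snd.mul ((contMDiffAt_unitChart_symm hu₀).comp (u₀, (1 : G)) contMDiffAt_fst)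
  have hf : ContMDiffAt (𝓘(ℝ, E).prod 𝓘(ℝ, E)) 𝓘(ℝ, E) ∞
      (Function.uncurry fun (u : E) (x : G) => unitChart E G (x * (unitChart E G).symm u))
      (u₀, 1) :=
    (contMDiffAt_unitChart hmem).comp (u₀, (1 : G)) h0
  have h := ContMDiffAt.mfderiv (I := 𝓘(ℝ, E)) (I' := 𝓘(ℝ, E)) (J := 𝓘(ℝ, E)) (n := ∞) (m := ∞)
    (x₀ := u₀) (fun (u : E) (x : G) => unitChart E G (x * (unitChart E G).symm u))
    (fun _ => (1 : G)) hf contMDiffAt_const (by simp)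
  refine h.congr_of_eventuallyEq (Filter.Eventually.of_forall fun u => ?_)
  -- The source base point is always `1` and the target is a vector space, so the coordinate changes
  -- in the parametric derivative are identities.
  have key := inTangentCoordinates_eq (I := 𝓘(ℝ, E)) (I' := 𝓘(ℝ, E)) (fun _ : E => (1 : G))
    (fun u : E => unitChart E G (1 * (unitChart E G).symm u)) (rightField E G) (x₀ := u₀) (x := u)
    (mem_chart_source E _) (by rw [chartAt_self_eq]; trivial)
  refine Eq.trans ?_ key.symm
  ext v
  simp only [ContinuousLinearMap.comp_apply]
  rw [(tangentBundleCore 𝓘(ℝ, E) G).coordChange_self _ _ (mem_achart_source E 1)]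
  exact ((tangentBundleCore 𝓘(ℝ, E) E).coordChange_self _ _ (mem_achart_source E _) _).symm

variable {c : ℝ → G} {s : Set ℝ} {t : ℝ} {q : E}

theorem HasLogDeriv.hasDerivWithinAt_unitChart (h : HasLogDeriv c s t q)
    (hc : c t ∈ (unitChart E G).source) :
    HasDerivWithinAt (fun τ => unitChart E G (c τ)) (rightField E G (unitChart E G (c t)) q) s t := by
  have hmd : MD (F := E) (F' := E) (unitChart E G) (c t) :=
    (contMDiffAt_unitChart hc).mdifferentiableAt (by simp)
  have h1 := hasVel_iff_hasDerivWithinAt.1 (HasVel.comp hmd h)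
  refine h1.congr_deriv ?_
  have hmd' : MD (F := E) (F' := E) (unitChart E G) (1 * c t) := by rwa [one_mul]
  have h2 := tmap_comp_apply (F := E) (F' := E) (F'' := E) (g := unitChart E G)
    (f := fun x : G => x * c t) (x := 1) hmd' (md_mul_right _ _) q
  rw [rightField, (unitChart E G).left_inv hc, h2, one_mul]
  rfl

/-- Near `x = e` the chart and its inverse cancel in `φ⁻¹(φ(x φ⁻¹(u)))`, leaving a right
translation. Solutions in the chart thus give solutions in `G`, and `rightField` inherits
injectivity from `rightT`. -/
theorem tmap_unitChart_symm_rightField {u : E} (hu : u ∈ (unitChart E G).target) (q : E) :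
    (tmap (unitChart E G).symm u : E →L[ℝ] E) (rightField E G u q)
      = rightT E ((unitChart E G).symm u) q := by
  have hsrc := (unitChart E G).map_target hu
  have hb : unitChart E G (1 * (unitChart E G).symm u) = u := by
    rw [one_mul, (unitChart E G).right_inv hu]
  have h1 : MD (F := E) (F' := E) (unitChart E G).symm
      (unitChart E G (1 * (unitChart E G).symm u)) := by
    rw [hb]; exact (contMDiffAt_unitChart_symm hu).mdifferentiableAt (by simp)
  have h3 : MD (F := E) (F' := E) (unitChart E G) (1 * (unitChart E G).symm u) := by
    rw [one_mul]; exact (contMDiffAt_unitChart hsrc).mdifferentiableAt (by simp)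
  have h2 := tmap_comp_apply (F := E) (F' := E) (F'' := E) (g := (unitChart E G).symm)
    (f := fun x : G => unitChart E G (x * (unitChart E G).symm u)) (x := 1) h1
    (MDifferentiableAt.comp (1 : G) h3 (md_mul_right _ _)) q
  rw [hb] at h2
  refine h2.symm.trans ?_
  have hcont : ContinuousAt (fun x : G => x * (unitChart E G).symm u) 1 :=
    (md_mul_right (E := E) _ _).continuousAt
  have hev : (fun x : G => (unitChart E G).symm (unitChart E G (x * (unitChart E G).symm u)))
      =ᶠ[𝓝 1] fun x => x * (unitChart E G).symm u := by
    have : ∀ᶠ x : G in 𝓝 1, x * (unitChart E G).symm u ∈ (unitChart E G).source := by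
      refine hcont.eventually_mem (isOpen_unitChart_source.mem_nhds ?_)
      rwa [one_mul]
    filter_upwards [this] with x hx using (unitChart E G).left_inv hx
  rw [tmap_congr hev]; rfl

theorem rightField_injective {u : E} (hu : u ∈ (unitChart E G).target) :
    Function.Injective (rightField E G u) := fun q q' h => by
  apply rightT_injective ((unitChart E G).symm u)
  rw [← tmap_unitChart_symm_rightField hu, h, tmap_unitChart_symm_rightField hu]

theorem hasLogDeriv_of_unitChart {u : ℝ → E} (hu : u t ∈ (unitChart E G).target)
    (h : HasDerivWithinAt u (rightField E G (u t) q) s t) :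
    HasLogDeriv (fun τ => (unitChart E G).symm (u τ)) s t q := by
  have h1 : MD (F := E) (F' := E) (unitChart E G).symm (u t) :=
    (contMDiffAt_unitChart_symm hu).mdifferentiableAt (by simp)
  have := HasVel.comp h1 (hasVel_iff_hasDerivWithinAt.2 h)
  rwa [tmap_unitChart_symm_rightField hu] at this

/-- Right translation preserves logarithmic derivatives, so `h` translated by `g a` continues `g`
beyond `a`. -/
theorem HasLogDeriv.extend {g h : ℝ → G} {q : ℝ → E} {a b : ℝ} (ha : 0 < a) (hb : 0 < b)
    (hg : ∀ t ∈ Icc 0 a, HasLogDeriv g (Icc 0 a) t (q t))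
    (hh : ∀ t ∈ Icc a (a + b), HasLogDeriv h (Icc a (a + b)) t (q t)) (h1 : h a = 1) :
    ∃ k : ℝ → G, k 0 = g 0 ∧
      ∀ t ∈ Icc 0 (a + b), HasLogDeriv k (Icc 0 (a + b)) t (q t) := by
  classical
  set k : ℝ → G := fun t => if t ≤ a then g t else h t * g a with hk
  have kl : ∀ t ≤ a, k t = g t := fun t ht => by simp [hk, ht]
  have kr : ∀ t, a ≤ t → k t = h t * g a := fun t ht => by
    rcases ht.eq_or_lt with rfl | h'
    · rw [kl _ le_rfl, h1, one_mul]
    · simp [hk, not_le.2 h']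
  have L1 : ∀ t ∈ Icc 0 a, HasLogDeriv k (Icc 0 a) t (q t) := fun t ht => by
    rw [HasLogDeriv, kl t ht.2]
    exact HasVel.congr (hg t ht) (fun y hy => kl y hy.2) (kl t ht.2)
  have L2 : ∀ t ∈ Icc a (a + b), HasLogDeriv k (Icc a (a + b)) t (q t) := fun t ht => by
    rw [HasLogDeriv, kr t ht.1]
    exact HasVel.congr ((hh t ht).comp_mul_const (g a)) (fun y hy => kr y hy.1) (kr t ht.1)
  refine ⟨k, kl 0 ha.le, fun t ht => ?_⟩
  have hun : Icc 0 a ∪ Icc a (a + b) = Icc 0 (a + b) :=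
    Icc_union_Icc_eq_Icc ha.le (by linarith)
  rcases lt_trichotomy t a with hta | rfl | hta
  · refine HasVel.mono_nhds (L1 t ⟨ht.1, hta.le⟩) ?_
    have : Iio a ∈ 𝓝 t := Iio_mem_nhds hta
    filter_upwards [mem_nhdsWithin_of_mem_nhds this, self_mem_nhdsWithin] with y hy hy'
    exact ⟨hy'.1, hy.le⟩
  -- At the junction both one-sided velocities equal `rightT E (k a) (q a)`, so they combine to one
  -- derivative on the union.
  · rw [← hun]
    exact HasVel.union (L1 t ⟨ht.1, le_rfl⟩) (L2 t ⟨le_rfl, ht.2⟩)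
  · refine HasVel.mono_nhds (L2 t ⟨hta.le, ht.2⟩) ?_
    have : Ioi a ∈ 𝓝 t := Ioi_mem_nhds hta
    filter_upwards [mem_nhdsWithin_of_mem_nhds this, self_mem_nhdsWithin] with y hy hy'
    exact ⟨hy.le, hy'.2⟩

/-- By right invariance every step restarts at the identity, in the same chart and with the same
`ε`; finitely many steps cover `[0,1]`. -/
theorem exists_hasLogDeriv [FiniteDimensional ℝ E] {q : ℝ → E} (hq : Continuous q) {B : ℝ}
    (hB : ∀ t, ‖q t‖ ≤ B) :
    ∃ g : ℝ → G, g 0 = 1 ∧ ∀ t ∈ Icc (0 : ℝ) 1, HasLogDeriv g (Icc (0 : ℝ) 1) t (q t) := by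
  have : CompleteSpace E := FiniteDimensional.complete ℝ E
  have hmem : unitChart E G 1 ∈ (unitChart E G).target :=
    (unitChart E G).map_source one_mem_unitChart_source
  obtain ⟨ε, hε, hloc⟩ := exists_uniform_local_solution
    ((contDiffAt_rightField hmem).of_le (by simp)) (isOpen_unitChart_target.mem_nhds hmem) hq hB
  have hloc' : ∀ t₀ : ℝ, ∃ g : ℝ → G, g t₀ = 1 ∧
      ∀ t ∈ Icc t₀ (t₀ + ε), HasLogDeriv g (Icc t₀ (t₀ + ε)) t (q t) := fun t₀ => by
    obtain ⟨u, hu0, hu⟩ := hloc t₀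
    refine ⟨fun t => (unitChart E G).symm (u t), ?_, fun t ht =>
      hasLogDeriv_of_unitChart (hu t ht).1 (hu t ht).2⟩
    simp only [hu0]
    exact (unitChart E G).left_inv one_mem_unitChart_source
  have hind : ∀ n : ℕ, ∃ g : ℝ → G, g 0 = 1 ∧
      ∀ t ∈ Icc 0 ((n + 1 : ℝ) * ε), HasLogDeriv g (Icc 0 ((n + 1 : ℝ) * ε)) t (q t) := by
    intro n
    induction n with
    | zero => simpa using hloc' 0
    | succ n ih =>
      obtain ⟨g, hg0, hg⟩ := ih
      obtain ⟨h, hh0, hh⟩ := hloc' ((n + 1 : ℝ) * ε)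
      obtain ⟨k, hk0, hk⟩ := HasLogDeriv.extend (by positivity) hε hg hh hh0
      refine ⟨k, hk0.trans hg0, ?_⟩
      have e : (n + 1 : ℝ) * ε + ε = ((n + 1 : ℕ) + 1 : ℝ) * ε := by push_cast; ring
      rwa [e] at hk
  obtain ⟨n, hn⟩ := exists_nat_gt (1 / ε)
  obtain ⟨g, hg0, hg⟩ := hind n
  have h1 : (1 : ℝ) ≤ (n + 1 : ℝ) * ε := by
    rw [div_lt_iff₀ hε] at hn; nlinarith
  exact ⟨g, hg0, fun t ht => HasVel.mono (hg t ⟨ht.1, ht.2.trans h1⟩) (Icc_subset_Icc_right h1)⟩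

/-- Translating by `(g t₀)⁻¹` moves the curve near `t₀` into the chart at the identity, where it
solves an ordinary differential equation with smooth right-hand side. -/
theorem contMDiffOn_of_hasLogDeriv [FiniteDimensional ℝ E] {g : ℝ → G} {q : ℝ → E}
    (hq : ContDiffOn ℝ ∞ q (Icc (0 : ℝ) 1))
    (hg : ∀ t ∈ Icc (0 : ℝ) 1, HasLogDeriv g (Icc (0 : ℝ) 1) t (q t)) :
    ContMDiffOn 𝓘(ℝ, ℝ) 𝓘(ℝ, E) ∞ g (Icc (0 : ℝ) 1) := by
  have : CompleteSpace E := FiniteDimensional.complete ℝ E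
  intro t₀ ht₀
  set x : ℝ → G := fun t => g t * (g t₀)⁻¹ with hx
  have hxd : ∀ t ∈ Icc (0 : ℝ) 1, HasLogDeriv x (Icc (0 : ℝ) 1) t (q t) := fun t ht =>
    (hg t ht).comp_mul_const _
  have hx0 : x t₀ = 1 := by simp [hx]
  have hsrc : x ⁻¹' (unitChart E G).source ∈ 𝓝[Icc 0 1] t₀ :=
    (HasVel.continuousWithinAt (hxd t₀ ht₀)) (isOpen_unitChart_source.mem_nhds
      (by rw [hx0]; exact one_mem_unitChart_source))
  obtain ⟨ε, hε, hb⟩ := (nhdsWithin_hasBasis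
    (Metric.nhds_basis_closedBall (x := t₀)) (Icc 0 1)).mem_iff.1 hsrc
  rw [Real.closedBall_eq_Icc, Icc_inter_Icc] at hb
  set a := max (t₀ - ε) 0
  set b := min (t₀ + ε) 1
  have hsub : Icc a b ⊆ Icc 0 1 := Icc_subset_Icc (le_max_right _ _) (min_le_right _ _)
  have hu : ContDiffOn ℝ ∞ (fun t => unitChart E G (x t)) (Icc a b) := by
    -- Bootstrapping: a solution of an equation with smooth right-hand side is smooth.
    refine ODE.contDiffOn_enat_Icc_of_hasDerivWithinAt (n := ⊤)
      (f := fun t u => rightField E G u (q t)) (u := (unitChart E G).target) ?_ ?_ ?_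
    · have h1 : ContDiffOn ℝ ∞ (fun p : ℝ × E => rightField E G p.2)
          (Icc a b ×ˢ (unitChart E G).target) := fun p hp =>
        ((contDiffAt_rightField hp.2).comp p contDiffAt_snd).contDiffWithinAt
      have h2 : ContDiffOn ℝ ∞ (fun p : ℝ × E => q p.1)
          (Icc a b ×ˢ (unitChart E G).target) :=
        hq.comp contDiffOn_fst fun p hp => hsub hp.1
      exact h1.clm_apply h2
    · intro t ht
      exact ((hxd t (hsub ht)).hasDerivWithinAt_unitChart (hb ht)).mono hsub
    · intro t ht
      exact (unitChart E G).map_source (hb ht)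
  have hmem : t₀ ∈ Icc a b := by
    simp only [a, b, mem_Icc, max_le_iff, le_min_iff]
    exact ⟨⟨by linarith, ht₀.1⟩, by linarith, ht₀.2⟩
  have hux : ContMDiffWithinAt 𝓘(ℝ, ℝ) 𝓘(ℝ, E) ∞
      (fun t => (unitChart E G).symm (unitChart E G (x t)) * g t₀) (Icc a b) t₀ := by
    have h1 := (contMDiffOn_unitChart_symm (E := E) (G := G)).comp hu.contMDiffOn
      (fun t ht => (unitChart E G).map_source (hb ht)) t₀ hmem
    exact (contMDiff_mul_right' (g t₀)).contMDiffAt.comp_contMDiffWithinAt t₀ h1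
  have hgx : ContMDiffWithinAt 𝓘(ℝ, ℝ) 𝓘(ℝ, E) ∞ g (Icc a b) t₀ := by
    refine hux.congr (fun t ht => ?_) ?_
    · rw [(unitChart E G).left_inv (hb ht)]; simp [hx]
    · rw [(unitChart E G).left_inv (hb hmem)]; simp [hx]
  refine hgx.mono_of_mem_nhdsWithin ?_
  have : Icc (t₀ - ε) (t₀ + ε) ∈ 𝓝 t₀ := Icc_mem_nhds (by linarith) (by linarith)
  filter_upwards [mem_nhdsWithin_of_mem_nhds this, self_mem_nhdsWithin] with y hy hy'
  exact ⟨max_le hy.1 hy'.1, le_min hy.2 hy'.2⟩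

theorem SmoothCurve.contDiffOn_extend (q : SmoothCurve E E) :
    ContDiffOn ℝ ∞ (IccExtend zero_le_one q) (Icc (0 : ℝ) 1) :=
  contMDiffOn_iff_contDiffOn.1 (contMDiff_iff_extend.1 q.contMDiff)

theorem exists_isEvolution [FiniteDimensional ℝ E] (q : SmoothCurve E E) :
    ∃ g : SmoothCurve E G, IsEvolution q g := by
  have hqc : Continuous (IccExtend zero_le_one q) := q.contMDiff.continuous.Icc_extend'
  obtain ⟨B, hB⟩ := isCompact_range (q.contMDiff.continuous) |>.isBounded.exists_norm_le
  obtain ⟨g, hg0, hg⟩ := exists_hasLogDeriv (G := G) hqc (B := B)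
    (fun t => hB _ (by simp [IccExtend]))
  refine ⟨SmoothCurve.ofReal g (contMDiffOn_of_hasLogDeriv q.contDiffOn_extend hg), ?_⟩
  rw [isEvolution_iff]
  refine ⟨hg0, fun t => ?_⟩
  have h1 := hg t t.2
  have e : IccExtend zero_le_one q (t : ℝ) = q t := by simp [IccExtend]
  rw [e] at h1
  have e2 : IccExtend zero_le_one (fun t : unitInterval => g t) t = g t := extend_ofReal t.2
  change HasLogDeriv (IccExtend zero_le_one (fun t : unitInterval => g t)) _ _ _
  rw [HasLogDeriv, e2]
  exact HasVel.congr h1 (fun y hy => extend_ofReal hy) e2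

theorem isEvolution_Evol [FiniteDimensional ℝ E] (q : SmoothCurve E E) :
    IsEvolution q (Evol q : SmoothCurve E G) := by
  have h : ∃ g : SmoothCurve E G, IsEvolution q g := exists_isEvolution q
  rw [Evol, dif_pos h]
  exact h.choose_spec

end Evolution

/-! ### Smoothness of the logarithmic derivative of a smooth curve -/

section LogDeriv

variable {E : Type*} [NormedAddCommGroup E] [NormedSpace ℝ E]
  {G : Type*} [TopologicalSpace G] [ChartedSpace E G] [Group G] [LieGroup 𝓘(ℝ, E) ∞ G]

/-- The right logarithmic derivative of a smooth curve is smooth. -/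
theorem contDiffWithinAt_logDeriv [FiniteDimensional ℝ E] {h : ℝ → G} {q : ℝ → E} {U : Set ℝ}
    (hU : IsOpen U) {t₀ : ℝ} (ht₀ : t₀ ∈ Icc (0 : ℝ) 1 ∩ U)
    (hh : ContMDiffOn 𝓘(ℝ, ℝ) 𝓘(ℝ, E) ∞ h (Icc (0 : ℝ) 1 ∩ U))
    (hq : ∀ t ∈ Icc (0 : ℝ) 1 ∩ U, HasLogDeriv h (Icc (0 : ℝ) 1 ∩ U) t (q t)) :
    ContDiffWithinAt ℝ ∞ q (Icc (0 : ℝ) 1) t₀ := by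
  have : CompleteSpace E := FiniteDimensional.complete ℝ E
  set x : ℝ → G := fun t => h t * (h t₀)⁻¹ with hx
  have hxd : ∀ t ∈ Icc (0 : ℝ) 1 ∩ U, HasLogDeriv x (Icc (0 : ℝ) 1 ∩ U) t (q t) := fun t ht =>
    (hq t ht).comp_mul_const _
  have hxc : ContMDiffOn 𝓘(ℝ, ℝ) 𝓘(ℝ, E) ∞ x (Icc (0 : ℝ) 1 ∩ U) :=
    (contMDiff_mul_right' (h t₀)⁻¹).comp_contMDiffOn hh
  have hx0 : x t₀ = 1 := by simp [hx]
  obtain ⟨V, hVo, hV⟩ := (continuousOn_iff'.1 hxc.continuousOn) _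
    (isOpen_unitChart_source (E := E) (G := G))
  set S := Icc (0 : ℝ) 1 ∩ (U ∩ V) with hS
  have hSU : S ⊆ Icc (0 : ℝ) 1 ∩ U := fun t ht => ⟨ht.1, ht.2.1⟩
  have hsrc : ∀ t ∈ S, x t ∈ (unitChart E G).source := fun t ht =>
    (hV.superset ⟨ht.2.2, hSU ht⟩ : t ∈ x ⁻¹' (unitChart E G).source ∩ _).1
  have ht₀V : t₀ ∈ V :=
    (hV.subset ⟨by rw [mem_preimage, hx0]; exact one_mem_unitChart_source, ht₀⟩).1
  have hUD : UniqueDiffOn ℝ S := uniqueDiffOn_Icc_zero_one.inter (hU.inter hVo)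
  have hu : ContDiffOn ℝ ∞ (fun t => unitChart E G (x t)) S := by
    rw [← contMDiffOn_iff_contDiffOn]
    exact contMDiffOn_unitChart.comp (hxc.mono hSU) hsrc
  have hu' : ContDiffOn ℝ ∞ (derivWithin (fun t => unitChart E G (x t)) S) S :=
    ((contDiffOn_infty_iff_derivWithin hUD).1 hu).2
  have hder : ∀ t ∈ S, derivWithin (fun t => unitChart E G (x t)) S t
      = rightField E G (unitChart E G (x t)) (q t) := fun t ht =>
    (((hxd t (hSU ht)).hasDerivWithinAt_unitChart (hsrc t ht)).mono hSU).derivWithin (hUD t ht)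
  -- Solve the chart equation `u' = rightField(u) q` for `q`: an injective endomorphism of a
  -- finite-dimensional space is invertible, and operator inversion is smooth at invertible
  -- operators.
  have hqe : ∀ t ∈ S, q t = (rightField E G (unitChart E G (x t))).inverse
      (derivWithin (fun t => unitChart E G (x t)) S t) := fun t ht => by
    have hinj := rightField_injective ((unitChart E G).map_source (hsrc t ht))
    set A := rightField E G (unitChart E G (x t))
    let e : E ≃L[ℝ] E := (LinearEquiv.ofInjectiveEndo (A : E →ₗ[ℝ] E) hinj).toContinuousLinearEquiv
    have he : (e : E →L[ℝ] E) = A := by ext; rfl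
    rw [hder t ht, ← he, ContinuousLinearMap.inverse_equiv]
    exact (e.symm_apply_apply _).symm
  have ht₀S : t₀ ∈ S := ⟨ht₀.1, ht₀.2, ht₀V⟩
  have hinv : ContDiffWithinAt ℝ ∞ (fun t => (rightField E G (unitChart E G (x t))).inverse) S t₀ := by
    have htgt := (unitChart E G).map_source (hsrc t₀ ht₀S)
    have hinj := rightField_injective htgt
    let e : E ≃L[ℝ] E := (LinearEquiv.ofInjectiveEndo
      (rightField E G (unitChart E G (x t₀)) : E →ₗ[ℝ] E) hinj).toContinuousLinearEquiv
    have he : (e : E →L[ℝ] E) = rightField E G (unitChart E G (x t₀)) := by ext; rfl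
    have h1 : ContDiffWithinAt ℝ ∞ (fun t => rightField E G (unitChart E G (x t))) S t₀ :=
      (contDiffAt_rightField htgt).comp_contDiffWithinAt (f := fun t => unitChart E G (x t)) t₀
        (hu t₀ ht₀S)
    have h2 := contDiffAt_map_inverse (n := ∞) e
    rw [he] at h2
    exact h2.comp_contDiffWithinAt t₀ h1
  have hfin : ContDiffWithinAt ℝ ∞ q S t₀ :=
    (hinv.clm_apply (hu' t₀ ht₀S)).congr hqe (hqe t₀ ht₀S)
  refine hfin.mono_of_mem_nhdsWithin ?_
  exact Filter.inter_mem self_mem_nhdsWithin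
    (mem_nhdsWithin_of_mem_nhds ((hU.inter hVo).mem_nhds ht₀S.2))

end LogDeriv

/-! ### Local sections and fibres of submersions -/

section Submersion

variable {E : Type*} [NormedAddCommGroup E] [NormedSpace ℝ E]
  {M : Type*} [TopologicalSpace M] [ChartedSpace E M] [IsManifold 𝓘(ℝ, E) ∞ M]
  {F : Type*} [NormedAddCommGroup F] [NormedSpace ℝ F]
  {N : Type*} [TopologicalSpace N] [ChartedSpace F N] [IsManifold 𝓘(ℝ, F) ∞ N]

open Manifold in
theorem exists_submersion_charts {f : M → N} {x : M}
    (hf : IsSubmersionAt 𝓘(ℝ, E) 𝓘(ℝ, F) ∞ f x) :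
    ∃ (φ : PartialEquiv M E) (ψ : PartialEquiv N F) (e : E ≃L[ℝ] F × hf.complement),
      IsOpen φ.source ∧ IsOpen φ.target ∧ IsOpen ψ.source ∧
      ContMDiffOn 𝓘(ℝ, E) 𝓘(ℝ, E) ∞ φ φ.source ∧
      ContMDiffOn 𝓘(ℝ, E) 𝓘(ℝ, E) ∞ φ.symm φ.target ∧
      ContMDiffOn 𝓘(ℝ, F) 𝓘(ℝ, F) ∞ ψ ψ.source ∧
      x ∈ φ.source ∧ (∀ z ∈ φ.source, f z ∈ ψ.source) ∧
      ∀ z ∈ φ.source, ψ (f z) = (e (φ z)).1 := by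
  have hφs : (hf.domChart.extend 𝓘(ℝ, E)).source = hf.domChart.source :=
    OpenPartialHomeomorph.extend_source _
  have hψs : (hf.codChart.extend 𝓘(ℝ, F)).source = hf.codChart.source :=
    OpenPartialHomeomorph.extend_source _
  refine ⟨hf.domChart.extend 𝓘(ℝ, E), hf.codChart.extend 𝓘(ℝ, F), hf.equiv, ?_,
    hf.domChart.isOpen_extend_target, ?_, ?_, ?_, ?_, ?_, fun z hz => ?_, fun z hz => ?_⟩
  · rw [hφs]; exact hf.domChart.open_source
  · rw [hψs]; exact hf.codChart.open_source
  · rw [hφs]; exact OpenPartialHomeomorph.contMDiffOn_extend hf.domChart_mem_maximalAtlas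
  · rw [OpenPartialHomeomorph.extend_target']
    exact contMDiffOn_extend_symm hf.domChart_mem_maximalAtlas
  · rw [hψs]; exact OpenPartialHomeomorph.contMDiffOn_extend hf.codChart_mem_maximalAtlas
  · rw [hφs]; exact hf.mem_domChart_source
  · rw [hψs]; rw [hφs] at hz; exact hf.source_subset_preimage_source hz
  · have := hf.writtenInCharts ((hf.domChart.extend 𝓘(ℝ, E)).map_source hz)
    simp only [Function.comp_apply] at this
    rw [(hf.domChart.extend 𝓘(ℝ, E)).left_inv hz] at this
    exact this

open Manifold in
/-- A submersion has smooth local sections. -/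
theorem exists_local_section {f : M → N} {x : M}
    (hf : IsSubmersionAt 𝓘(ℝ, E) 𝓘(ℝ, F) ∞ f x) :
    ∃ (σ : N → M) (V : Set N), IsOpen V ∧ f x ∈ V ∧ σ (f x) = x ∧
      ContMDiffOn 𝓘(ℝ, F) 𝓘(ℝ, E) ∞ σ V ∧ ∀ y ∈ V, f (σ y) = y := by
  obtain ⟨φ, ψ, e, hφo, hφt, hψo, hφc, hφsc, hψc, hx, hmaps, hψφ⟩ := exists_submersion_charts hf
  -- In the charts `f` is the first projection; the section freezes the second component at its
  -- value for `x`.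
  set τ : N → E := fun y => e.symm (ψ y, (e (φ x)).2) with hτ
  have hτs : ContMDiffOn 𝓘(ℝ, F) 𝓘(ℝ, E) ∞ τ ψ.source := by
    have h2 : ContDiff ℝ ∞ fun w : F => e.symm (w, (e (φ x)).2) :=
      e.symm.contDiff.comp (contDiff_id.prodMk contDiff_const)
    exact h2.contMDiff.comp_contMDiffOn hψc
  have hopen : IsOpen (ψ.source ∩ τ ⁻¹' φ.target) :=
    hτs.continuousOn.isOpen_inter_preimage hψo hφt
  have hτx : τ (f x) = φ x := by
    simp only [hτ]
    rw [hψφ x hx, Prod.mk.eta, e.symm_apply_apply]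
  refine ⟨fun y => φ.symm (τ y), ψ.source ∩ τ ⁻¹' φ.target, hopen, ⟨hmaps x hx, ?_⟩, ?_, ?_, ?_⟩
  · rw [mem_preimage, hτx]; exact φ.map_source hx
  · simp only [hτx]; exact φ.left_inv hx
  · exact hφsc.comp
      (hτs.mono inter_subset_left) fun y hy => hy.2
  · intro y hy
    have hz := φ.map_target hy.2
    refine ψ.injOn (hmaps _ hz) hy.1 ?_
    rw [hψφ _ hz, φ.right_inv hy.2]
    simp [hτ]

/-- In submersion charts the kernel of the tangent map is the complement factor, so moving along the
image of `v` stays in the fibre. Applied to the projection it shows `ker T_e π ⊆ 𝔥`. -/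
theorem exists_curve_in_fiber {f : M → N} {x : M}
    (hf : Manifold.IsSubmersionAt 𝓘(ℝ, E) 𝓘(ℝ, F) ∞ f x) {v : E}
    (hv : (tmap f x : E →L[ℝ] F) v = 0) :
    ∃ γ : ℝ → M, ContMDiff 𝓘(ℝ, ℝ) 𝓘(ℝ, E) ∞ γ ∧ (∀ s, f (γ s) = f x) ∧ γ 0 = x ∧
      (tmap γ 0 : ℝ →L[ℝ] E) 1 = v := by
  obtain ⟨φ, ψ, e, hφo, hφt, hψo, hφc, hφsc, hψc, hx, hmaps, hψφ⟩ := exists_submersion_charts hf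
  have hφd : MD (F := E) (F' := E) φ x :=
    (hφc.contMDiffAt (hφo.mem_nhds hx)).mdifferentiableAt (by simp)
  have hφsd : MD (F := E) (F' := E) φ.symm (φ x) :=
    (hφsc.contMDiffAt (hφt.mem_nhds (φ.map_source hx))).mdifferentiableAt (by simp)
  have hψd : MD (F := F) (F' := F) ψ (f x) :=
    (hψc.contMDiffAt (hψo.mem_nhds (hmaps x hx))).mdifferentiableAt (by simp)
  set w : E := (tmap φ x : E →L[ℝ] E) v with hwdef
  have hfst : (e w).1 = 0 := by
    have h1 := tmap_comp_apply (F := E) (F' := F) (F'' := F) (g := ψ) (f := f) (x := x) hψd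
      (hf.contMDiffAt.mdifferentiableAt (by simp)) v
    rw [hv, map_zero] at h1
    set K : E →L[ℝ] F := (ContinuousLinearMap.fst ℝ F hf.complement) ∘L (e : E →L[ℝ] _) with hK
    have h2 := tmap_comp_apply (F := E) (F' := E) (F'' := F) (g := K) (f := φ) (x := x)
      K.differentiableAt.mdifferentiableAt hφd v
    have h3 : (tmap K (φ x) : E →L[ℝ] F) = K := K.mfderiv_eq
    have hev : (fun y => ψ (f y)) =ᶠ[𝓝 x] fun y => K (φ y) := by
      filter_upwards [hφo.mem_nhds hx] with y hy using hψφ y hy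
    rw [tmap_congr hev, h2, h3] at h1
    exact h1
  obtain ⟨r, hr, hball⟩ := Metric.isOpen_iff.1 hφt _ (φ.map_source hx)
  set δ : ℝ := r / (‖w‖ + 1) with hδ
  have hδ0 : 0 < δ := by positivity
  -- The curve must be defined on all of `ℝ`. The factor `δ sin(s/δ)` has derivative 1 at 0 and size
  -- at most `δ`, and `δ ‖w‖ < r` keeps `α` in the chart.
  set α : ℝ → E := fun s => φ x + (δ * Real.sin (δ⁻¹ * s)) • w with hα
  have hαt : ∀ s, α s ∈ φ.target := fun s => hball (by
    rw [Metric.mem_ball, dist_eq_norm, hα]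
    simp only [add_sub_cancel_left, norm_smul, norm_mul, Real.norm_eq_abs, abs_of_pos hδ0]
    calc δ * |Real.sin (δ⁻¹ * s)| * ‖w‖ ≤ δ * 1 * ‖w‖ := by
          gcongr; exact Real.abs_sin_le_one _
      _ < δ * (‖w‖ + 1) := by nlinarith
      _ = r := by rw [hδ]; field_simp)
  have hαc : ContDiff ℝ ∞ α := contDiff_const.add
    ((contDiff_const.mul (Real.contDiff_sin.comp (contDiff_const.mul contDiff_id))).smul
      contDiff_const)
  have hα0 : α 0 = φ x := by simp [hα]
  have hαd : HasDerivAt α w 0 := by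
    have h1 : HasDerivAt (fun s : ℝ => δ⁻¹ * s) δ⁻¹ 0 := by
      simpa using (hasDerivAt_id (0 : ℝ)).const_mul δ⁻¹
    have h2 := (((Real.hasDerivAt_sin _).comp (0 : ℝ) h1).const_mul δ).smul_const w
    have h3 := h2.const_add (φ x)
    refine h3.congr_deriv ?_
    simp [mul_inv_cancel₀ hδ0.ne']
  refine ⟨fun s => φ.symm (α s), ?_, fun s => ?_, ?_, ?_⟩
  · exact contMDiffOn_univ.1 (hφsc.comp hαc.contMDiff.contMDiffOn fun s _ => hαt s)
  · have hz := φ.map_target (hαt s)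
    refine ψ.injOn (hmaps _ hz) (hmaps _ hx) ?_
    rw [hψφ _ hz, hψφ _ hx, φ.right_inv (hαt s)]
    simp [hα, hfst]
  · simp only [hα0]; exact φ.left_inv hx
  · have hφsd' : MD (F := E) (F' := E) φ.symm (α 0) := by rwa [hα0]
    have h1 := tmap_comp_apply (F := ℝ) (F' := E) (F'' := E) (g := φ.symm) (f := α) (x := 0)
      hφsd' hαd.differentiableAt.mdifferentiableAt 1
    have h2 : (tmap α 0 : ℝ →L[ℝ] E) 1 = w := by
      rw [tmap, mfderiv_eq_fderiv]
      exact fderiv_apply_one_eq_deriv.trans hαd.deriv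
    rw [h2, hα0] at h1
    have h3 := tmap_comp_apply (F := E) (F' := E) (F'' := E) (g := φ.symm) (f := φ) (x := x)
      hφsd hφd v
    have hev : (fun y => φ.symm (φ y)) =ᶠ[𝓝 x] fun y => y := by
      filter_upwards [hφo.mem_nhds hx] with y hy using φ.left_inv hy
    rw [tmap_congr hev, tmap_id] at h3
    exact h1.trans h3.symm

end Submersion

/-! ### The action on the homogeneous space and its fundamental vector fields -/

section Action

variable {E : Type*} [NormedAddCommGroup E] [NormedSpace ℝ E]
  {G : Type*} [TopologicalSpace G] [ChartedSpace E G] [Group G] [LieGroup 𝓘(ℝ, E) ∞ G]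
  {F : Type*} [NormedAddCommGroup F] [NormedSpace ℝ F]
  {H : Subgroup G} [ChartedSpace F (G ⧸ H)] [IsManifold 𝓘(ℝ, F) ∞ (G ⧸ H)]

/-- With a local section `σ` of the projection, the action is `(g, x) ↦ π(g σ(x))` near any given
point. -/
theorem contMDiff_action
    (hπ : Manifold.IsSubmersion 𝓘(ℝ, E) 𝓘(ℝ, F) ∞ (QuotientGroup.mk : G → G ⧸ H)) :
    ContMDiff (𝓘(ℝ, E).prod 𝓘(ℝ, F)) 𝓘(ℝ, F) ∞ fun p : G × (G ⧸ H) => p.1 • p.2 := by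
  have : IsManifold 𝓘(ℝ, E) ∞ G := inferInstance
  rintro ⟨g, x⟩
  obtain ⟨k, rfl⟩ := QuotientGroup.mk_surjective x
  obtain ⟨σ, V, hV, hkV, -, hσ, hs⟩ := exists_local_section (hπ.isSubmersionAt k)
  have h1 : ContMDiffAt (𝓘(ℝ, E).prod 𝓘(ℝ, F)) 𝓘(ℝ, E) ∞
      (fun p : G × (G ⧸ H) => p.1 * σ p.2) (g, (k : G ⧸ H)) :=
    contMDiffAt_fst.mul ((hσ.contMDiffAt (hV.mem_nhds hkV)).comp (g, (k : G ⧸ H)) contMDiffAt_snd)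
  have h2 : ContMDiffAt (𝓘(ℝ, E).prod 𝓘(ℝ, F)) 𝓘(ℝ, F) ∞
      (fun p : G × (G ⧸ H) => ((p.1 * σ p.2 : G) : G ⧸ H)) (g, (k : G ⧸ H)) :=
    hπ.contMDiff.contMDiffAt.comp (g, (k : G ⧸ H)) h1
  refine h2.congr_of_eventuallyEq ?_
  have : ∀ᶠ p : G × (G ⧸ H) in 𝓝 (g, (k : G ⧸ H)), p.2 ∈ V :=
    continuous_snd.continuousAt.eventually_mem (hV.mem_nhds hkV)
  filter_upwards [this] with p hp
  conv_lhs => rw [← hs p.2 hp]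
  rfl

theorem md_smul
    (hπ : Manifold.IsSubmersion 𝓘(ℝ, E) 𝓘(ℝ, F) ∞ (QuotientGroup.mk : G → G ⧸ H))
    (g : G) (x : G ⧸ H) : MD (F := F) (F' := F) (fun y : G ⧸ H => g • y) x :=
  ((contMDiff_action hπ).comp (contMDiff_const.prodMk contMDiff_id)).mdifferentiable
    (by simp) x

theorem md_orbit
    (hπ : Manifold.IsSubmersion 𝓘(ℝ, E) 𝓘(ℝ, F) ∞ (QuotientGroup.mk : G → G ⧸ H))
    (x : G ⧸ H) (g : G) : MD (F := E) (F' := F) (fun a : G => a • x) g :=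
  ((contMDiff_action hπ).comp (contMDiff_id.prodMk contMDiff_const)).mdifferentiable
    (by simp) g

variable (E F) in
/-- The tangent map at `e` of the orbit map `g ↦ g • x`. -/
def orbitT (x : G ⧸ H) : E →L[ℝ] F := tmap (fun g : G => g • x) 1

theorem orbitT_one : orbitT E F ((1 : G) : G ⧸ H) = tangentProj E F H := by
  have : (fun g : G => g • ((1 : G) : G ⧸ H)) = QuotientGroup.mk := by
    funext g
    rw [MulAction.Quotient.smul_coe, smul_eq_mul, mul_one]
  rw [orbitT, this]; rfl

theorem tmap_orbit_rightT
    (hπ : Manifold.IsSubmersion 𝓘(ℝ, E) 𝓘(ℝ, F) ∞ (QuotientGroup.mk : G → G ⧸ H))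
    (x : G ⧸ H) (k : G) (q : E) :
    (tmap (fun g : G => g • x) k : E →L[ℝ] F) (rightT E k q) = orbitT E F (k • x) q := by
  have h1 := tmap_comp_apply (F := E) (F' := E) (F'' := F) (g := fun g : G => g • x)
    (f := fun a : G => a * k) (x := 1) (md_orbit hπ x _) (md_mul_right k _) q
  simp only [mul_smul, one_mul] at h1
  exact h1.symm

/-- Equivariance of fundamental vector fields, from `g . (a . x) = (g a g⁻¹) . (g . x)`. -/
theorem tmap_smul_orbitT
    (hπ : Manifold.IsSubmersion 𝓘(ℝ, E) 𝓘(ℝ, F) ∞ (QuotientGroup.mk : G → G ⧸ H))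
    (g : G) (x : G ⧸ H) (q : E) :
    (tmap (fun y : G ⧸ H => g • y) x : F →L[ℝ] F) (orbitT E F x q)
      = orbitT E F (g • x) (Ad g q) := by
  have h1 := tmap_comp_apply (F := E) (F' := F) (F'' := F) (g := fun y : G ⧸ H => g • y)
    (f := fun a : G => a • x) (x := 1) (md_smul hπ g _) (md_orbit hπ x _) q
  have h2 := tmap_comp_apply (F := E) (F' := E) (F'' := F) (g := fun a : G => a • (g • x))
    (f := fun a : G => g * a * g⁻¹) (x := 1) (md_orbit hπ _ _) (md_conj g _) q
  have e : (fun y : G => (g * y * g⁻¹) • (g • x)) = fun y => g • y • x := by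
    funext y; simp [smul_smul]
  rw [e, h1, one_smul] at h2
  simp only [mul_one, mul_inv_cancel] at h2
  exact h2

theorem tmap_smul_inv_smul
    (hπ : Manifold.IsSubmersion 𝓘(ℝ, E) 𝓘(ℝ, F) ∞ (QuotientGroup.mk : G → G ⧸ H))
    (g : G) (x : G ⧸ H) (v : F) :
    (tmap (fun y : G ⧸ H => g • y) (g⁻¹ • x) : F →L[ℝ] F)
      ((tmap (fun y : G ⧸ H => g⁻¹ • y) x : F →L[ℝ] F) v) = v := by
  have h1 := tmap_comp_apply (F := F) (F' := F) (F'' := F) (g := fun y : G ⧸ H => g • y)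
    (f := fun y : G ⧸ H => g⁻¹ • y) (x := x) (md_smul hπ g _) (md_smul hπ g⁻¹ _) v
  simp only [smul_inv_smul] at h1
  rw [tmap_id] at h1
  exact h1.symm

/-- Product rule for the action, with velocities in `G ⧸ H` written through fundamental vector
fields; it parallels `HasLogDeriv.mul`. -/
theorem HasVel.smul
    (hπ : Manifold.IsSubmersion 𝓘(ℝ, E) 𝓘(ℝ, F) ∞ (QuotientGroup.mk : G → G ⧸ H))
    {k : ℝ → G} {c : ℝ → G ⧸ H} {s : Set ℝ} {t : ℝ} {p q : E}
    (hk : HasLogDeriv k s t q) (hc : HasVel c s t (orbitT E F (c t) p)) :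
    HasVel (fun τ => k τ • c τ) s t (orbitT E F (k t • c t) (q + Ad (k t) p)) := by
  have h := HasVel.comp₂ (f := fun (a : G) (x : G ⧸ H) => a • x) (F'' := F)
    ((contMDiff_action hπ).mdifferentiable (by simp) _) hk hc
  rw [tmap_orbit_rightT hπ, tmap_smul_orbitT hπ, ← map_add] at h
  exact h

theorem HasLogDeriv.hasVel_smul
    (hπ : Manifold.IsSubmersion 𝓘(ℝ, E) 𝓘(ℝ, F) ∞ (QuotientGroup.mk : G → G ⧸ H))
    {k : ℝ → G} (x : G ⧸ H) {s : Set ℝ} {t : ℝ} {q : E} (hk : HasLogDeriv k s t q) :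
    HasVel (fun τ => k τ • x) s t (orbitT E F (k t • x) q) := by
  have h0 : HasVel (fun _ : ℝ => x) s t (orbitT E F x (0 : E)) := by
    rw [map_zero]; exact hasVel_const x
  have := HasVel.smul hπ hk h0
  rwa [map_zero, add_zero] at this

/-! ### The isotropy Lie algebra and the form `ω` -/

theorem tangentProj_surjective
    (hπ : Manifold.IsSubmersion 𝓘(ℝ, E) 𝓘(ℝ, F) ∞ (QuotientGroup.mk : G → G ⧸ H)) :
    Function.Surjective (tangentProj E F H) := by
  have : IsManifold 𝓘(ℝ, E) ∞ G := inferInstance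
  intro v
  obtain ⟨σ, V, hV, h1V, hσ1, hσ, hs⟩ := exists_local_section (hπ.isSubmersionAt (1 : G))
  refine ⟨(tmap σ ((1 : G) : G ⧸ H) : F →L[ℝ] E) v, ?_⟩
  have h1 := tmap_comp_apply (F := F) (F' := E) (F'' := F) (g := (QuotientGroup.mk : G → G ⧸ H))
    (f := σ) (x := ((1 : G) : G ⧸ H)) (hπ.contMDiff.mdifferentiable (by simp) _)
    ((hσ.contMDiffAt (hV.mem_nhds h1V)).mdifferentiableAt (by simp)) v
  have hev : (fun y => ((σ y : G) : G ⧸ H)) =ᶠ[𝓝 ((1 : G) : G ⧸ H)] fun y => y := by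
    filter_upwards [hV.mem_nhds h1V] with y hy using hs y hy
  rw [tmap_congr hev, tmap_id, hσ1] at h1
  exact h1.symm

/-- The projection is constant along curves in `H`. Conversely, a kernel vector is the velocity of a
curve in the fibre over `eH`, which is `H`. -/
theorem mem_lieAlgebraOf_iff
    (hπ : Manifold.IsSubmersion 𝓘(ℝ, E) 𝓘(ℝ, F) ∞ (QuotientGroup.mk : G → G ⧸ H)) (v : E) :
    v ∈ lieAlgebraOf H ↔ tangentProj E F H v = 0 := by
  have : IsManifold 𝓘(ℝ, E) ∞ G := inferInstance
  constructor
  · rintro ⟨γ, hγ, hγH, hγ0, rfl⟩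
    have h1 := tmap_comp_apply (F := ℝ) (F' := E) (F'' := F) (g := (QuotientGroup.mk : G → G ⧸ H))
      (f := γ) (x := (0 : ℝ)) (hπ.contMDiff.mdifferentiable (by simp) _)
      (hγ.mdifferentiable (by simp) _) 1
    have hcst : (fun s => ((γ s : G) : G ⧸ H)) = fun _ => ((1 : G) : G ⧸ H) := by
      funext s
      exact ((QuotientGroup.eq).2 (by simpa using hγH s)).symm
    have h2 : (tmap (fun _ : ℝ => ((1 : G) : G ⧸ H)) 0 : ℝ →L[ℝ] F) = 0 := mfderiv_const
    rw [hcst, hγ0, h2] at h1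
    exact h1.symm
  · intro hv
    obtain ⟨γ, hγ, hf, hγ0, hγv⟩ := exists_curve_in_fiber (hπ.isSubmersionAt (1 : G)) (v := v) hv
    refine ⟨γ, hγ, fun s => ?_, hγ0, hγv⟩
    simpa using (QuotientGroup.eq).1 (hf s).symm

section Omega

variable [FiniteDimensional ℝ E] {𝔪 : Submodule ℝ E}

/-- As `T_e π` is onto with kernel `𝔥`, it is bijective on the complement `𝔪`. Hence the `inverse`
in `omegaE` is a true inverse and not the default value zero. -/
theorem exists_equiv_tangentProj
    (hπ : Manifold.IsSubmersion 𝓘(ℝ, E) 𝓘(ℝ, F) ∞ (QuotientGroup.mk : G → G ⧸ H))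
    (hc : IsCompl (lieAlgebraOf H) 𝔪) :
    ∃ e : 𝔪 ≃L[ℝ] F, (e : 𝔪 →L[ℝ] F) = tangentProj E F H ∘L 𝔪.subtypeL := by
  have hbij : Function.Bijective (tangentProj E F H ∘L 𝔪.subtypeL) := by
    constructor
    · rw [injective_iff_map_eq_zero]
      intro m hm
      have h1 : (m : E) ∈ lieAlgebraOf H := (mem_lieAlgebraOf_iff hπ _).2 hm
      exact Subtype.ext (Submodule.disjoint_def.1 hc.disjoint _ h1 m.2)
    · intro v
      obtain ⟨x, rfl⟩ := tangentProj_surjective hπ v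
      obtain ⟨h, hh, m, hm, rfl⟩ := Submodule.mem_sup.1
        (hc.codisjoint.eq_top ▸ Submodule.mem_top : x ∈ lieAlgebraOf H ⊔ 𝔪)
      refine ⟨⟨m, hm⟩, ?_⟩
      rw [map_add, (mem_lieAlgebraOf_iff hπ h).1 hh, zero_add]
      rfl
  refine ⟨(LinearEquiv.ofBijective ((tangentProj E F H ∘L 𝔪.subtypeL : 𝔪 →L[ℝ] F) : 𝔪 →ₗ[ℝ] F)
    hbij).toContinuousLinearEquiv, ?_⟩
  ext m; rfl

theorem omegaE_tangentProj
    (hπ : Manifold.IsSubmersion 𝓘(ℝ, E) 𝓘(ℝ, F) ∞ (QuotientGroup.mk : G → G ⧸ H))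
    (hc : IsCompl (lieAlgebraOf H) 𝔪) {m : E} (hm : m ∈ 𝔪) :
    omegaE (F := F) H 𝔪 (tangentProj E F H m) = m := by
  obtain ⟨e, he⟩ := exists_equiv_tangentProj hπ hc
  rw [omegaE, ← he, ContinuousLinearMap.inverse_equiv]
  have : tangentProj E F H m = e ⟨m, hm⟩ := by
    change _ = (e : 𝔪 →L[ℝ] F) ⟨m, hm⟩
    rw [he]; rfl
  rw [this]
  simp

theorem tangentProj_omegaE
    (hπ : Manifold.IsSubmersion 𝓘(ℝ, E) 𝓘(ℝ, F) ∞ (QuotientGroup.mk : G → G ⧸ H))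
    (hc : IsCompl (lieAlgebraOf H) 𝔪) (v : F) :
    tangentProj E F H (omegaE (F := F) H 𝔪 v) = v := by
  obtain ⟨e, he⟩ := exists_equiv_tangentProj hπ hc
  rw [omegaE, ← he, ContinuousLinearMap.inverse_equiv]
  have : ∀ m : 𝔪, tangentProj E F H m = e m := fun m => by
    change _ = (e : 𝔪 →L[ℝ] F) m
    rw [he]; rfl
  change tangentProj E F H (e.symm v : 𝔪) = v
  rw [this]
  simp

theorem omegaE_mem (v : F) : omegaE (F := F) H 𝔪 v ∈ 𝔪 := by
  simp [omegaE]

theorem inv_smul_coset {g : G} {x : G ⧸ H} (hg : (g : G ⧸ H) = x) :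
    g⁻¹ • x = ((1 : G) : G ⧸ H) := by
  rw [← hg, MulAction.Quotient.smul_coe, smul_eq_mul, inv_mul_cancel]

theorem omegaAt_orbitT
    (hπ : Manifold.IsSubmersion 𝓘(ℝ, E) 𝓘(ℝ, F) ∞ (QuotientGroup.mk : G → G ⧸ H))
    {g : G} {x : G ⧸ H} (hg : (g : G ⧸ H) = x) (q : E) :
    omegaAt 𝔪 g x (orbitT E F x q)
      = Ad g (omegaE (F := F) H 𝔪 (tangentProj E F H (Ad g⁻¹ q))) := by
  have h1 : omegaAt 𝔪 g x (orbitT E F x q) = Ad g (omegaE (F := F) H 𝔪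
    ((tmap (fun y : G ⧸ H => g⁻¹ • y) x : F →L[ℝ] F) (orbitT E F x q))) := rfl
  rw [h1, tmap_smul_orbitT hπ, inv_smul_coset hg, orbitT_one]

theorem omegaAt_orbitT_Ad
    (hπ : Manifold.IsSubmersion 𝓘(ℝ, E) 𝓘(ℝ, F) ∞ (QuotientGroup.mk : G → G ⧸ H))
    (hc : IsCompl (lieAlgebraOf H) 𝔪)
    {g : G} {x : G ⧸ H} (hg : (g : G ⧸ H) = x) {m : E} (hm : m ∈ 𝔪) :
    omegaAt 𝔪 g x (orbitT E F x (Ad g m)) = Ad g m := by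
  rw [omegaAt_orbitT hπ hg, Ad_inv_apply_Ad, omegaE_tangentProj hπ hc hm]

/-- Transport `v` to the base point by `g⁻¹`, lift it to `𝔪` there, and transport back by
equivariance. -/
theorem exists_eq_orbitT_Ad
    (hπ : Manifold.IsSubmersion 𝓘(ℝ, E) 𝓘(ℝ, F) ∞ (QuotientGroup.mk : G → G ⧸ H))
    (hc : IsCompl (lieAlgebraOf H) 𝔪)
    {g : G} {x : G ⧸ H} (hg : (g : G ⧸ H) = x) (v : F) :
    ∃ m ∈ 𝔪, v = orbitT E F x (Ad g m) := by
  set w : F := (tmap (fun y : G ⧸ H => g⁻¹ • y) x : F →L[ℝ] F) v with hw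
  refine ⟨omegaE (F := F) H 𝔪 w, omegaE_mem w, ?_⟩
  have h1 := tmap_smul_orbitT hπ g (g⁻¹ • x) (omegaE (F := F) H 𝔪 w)
  rw [smul_inv_smul] at h1
  rw [← h1]
  have h2 : orbitT E F (g⁻¹ • x) (omegaE (F := F) H 𝔪 w) = w := by
    rw [inv_smul_coset hg, orbitT_one, tangentProj_omegaE hπ hc]
  rw [h2, hw, tmap_smul_inv_smul hπ]

/-- Write `g = g' h` with `h ∈ H`, so that `Ad(g) m = Ad(g')(Ad(h) m)`. The invariance of `𝔪` puts
`Ad(h) m` in `𝔪`, and both sides return the same vector. -/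
theorem omegaAt_eq_of_mk_eq
    (hπ : Manifold.IsSubmersion 𝓘(ℝ, E) 𝓘(ℝ, F) ∞ (QuotientGroup.mk : G → G ⧸ H))
    (h𝔪 : IsReductiveComplement H 𝔪) {g g' : G} {x : G ⧸ H}
    (hg : (g : G ⧸ H) = x) (hg' : (g' : G ⧸ H) = x) (v : F) :
    omegaAt 𝔪 g x v = omegaAt 𝔪 g' x v := by
  obtain ⟨m, hm, rfl⟩ := exists_eq_orbitT_Ad hπ h𝔪.1 hg v
  have hH : g'⁻¹ * g ∈ H := QuotientGroup.eq.1 (hg'.trans hg.symm)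
  have e : Ad g m = Ad g' (Ad (g'⁻¹ * g) m) := by
    rw [← Ad_mul_apply, mul_inv_cancel_left]
  rw [omegaAt_orbitT_Ad hπ h𝔪.1 hg hm, e, omegaAt_orbitT_Ad hπ h𝔪.1 hg' (h𝔪.2 _ hH m hm)]

theorem omega_eq_omegaAt
    (hπ : Manifold.IsSubmersion 𝓘(ℝ, E) 𝓘(ℝ, F) ∞ (QuotientGroup.mk : G → G ⧸ H))
    (h𝔪 : IsReductiveComplement H 𝔪) {g : G} {x : G ⧸ H} (hg : (g : G ⧸ H) = x) (v : F) :
    omega 𝔪 x v = omegaAt 𝔪 g x v :=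
  omegaAt_eq_of_mk_eq hπ h𝔪 (QuotientGroup.out_eq' x) hg v

/-- Each tangent vector is the value of the fundamental vector field of its image under `ω`; this is
what allows a curve to be rebuilt from `θ_ω(ċ)`. -/
theorem orbitT_omega
    (hπ : Manifold.IsSubmersion 𝓘(ℝ, E) 𝓘(ℝ, F) ∞ (QuotientGroup.mk : G → G ⧸ H))
    (h𝔪 : IsReductiveComplement H 𝔪) (x : G ⧸ H) (v : F) :
    orbitT E F x (omega 𝔪 x v) = v := by
  obtain ⟨g, hg⟩ := QuotientGroup.mk_surjective x
  obtain ⟨m, hm, rfl⟩ := exists_eq_orbitT_Ad hπ h𝔪.1 hg v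
  rw [omega_eq_omegaAt hπ h𝔪 hg, omegaAt_orbitT_Ad hπ h𝔪.1 hg hm]

theorem Ad_inv_omega_mem
    (hπ : Manifold.IsSubmersion 𝓘(ℝ, E) 𝓘(ℝ, F) ∞ (QuotientGroup.mk : G → G ⧸ H))
    (h𝔪 : IsReductiveComplement H 𝔪) {g : G} {x : G ⧸ H} (hg : (g : G ⧸ H) = x) (v : F) :
    Ad g⁻¹ (omega 𝔪 x v) ∈ 𝔪 := by
  obtain ⟨m, hm, rfl⟩ := exists_eq_orbitT_Ad hπ h𝔪.1 hg v
  rw [omega_eq_omegaAt hπ h𝔪 hg, omegaAt_orbitT_Ad hπ h𝔪.1 hg hm, Ad_inv_apply_Ad]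
  exact hm

/-- `θ_ω(ċ)` is a smooth curve. -/
theorem contMDiff_thetaD
    (hπ : Manifold.IsSubmersion 𝓘(ℝ, E) 𝓘(ℝ, F) ∞ (QuotientGroup.mk : G → G ⧸ H))
    (h𝔪 : IsReductiveComplement H 𝔪) (c : SmoothCurve F (G ⧸ H)) :
    ContMDiff (𝓡∂ 1) 𝓘(ℝ, E) ∞ (thetaD 𝔪 c) := by
  have : IsManifold 𝓘(ℝ, E) ∞ G := inferInstance
  rw [contMDiff_iff_extend]
  intro t₀ ht₀
  rw [contMDiffWithinAt_iff_contDiffWithinAt]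
  set ĉ : ℝ → G ⧸ H := IccExtend zero_le_one c with hĉ
  have hcs : ContMDiffOn 𝓘(ℝ, ℝ) 𝓘(ℝ, F) ∞ ĉ (Icc 0 1) := contMDiff_iff_extend.1 c.contMDiff
  obtain ⟨g₀, hg₀⟩ := QuotientGroup.mk_surjective (ĉ t₀)
  obtain ⟨σ, V, hV, h1V, -, hσ, hs⟩ := exists_local_section (hπ.isSubmersionAt g₀)
  rw [hg₀] at h1V
  obtain ⟨U, hU, hUV⟩ := continuousOn_iff'.1 hcs.continuousOn V hV
  have ht₀U : t₀ ∈ U := (hUV.subset ⟨h1V, ht₀⟩).1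
  have hUc : ∀ t ∈ Icc (0 : ℝ) 1 ∩ U, ĉ t ∈ V := fun t ht => (hUV.superset ⟨ht.2, ht.1⟩).1
  -- A local smooth lift of the curve to `G`; its logarithmic derivative `η` is smooth at `t₀`.
  set h : ℝ → G := fun t => σ (ĉ t) with hh
  have hhs : ContMDiffOn 𝓘(ℝ, ℝ) 𝓘(ℝ, E) ∞ h (Icc 0 1 ∩ U) :=
    hσ.comp (hcs.mono inter_subset_left) hUc
  have hhc : ∀ t ∈ Icc (0 : ℝ) 1 ∩ U, ((h t : G) : G ⧸ H) = ĉ t := fun t ht => hs _ (hUc t ht)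
  have hUD : UniqueDiffOn ℝ (Icc (0 : ℝ) 1 ∩ U) := uniqueDiffOn_Icc_zero_one.inter hU
  have hex : ∀ t : ℝ, ∃ q : E, t ∈ Icc (0 : ℝ) 1 ∩ U → HasLogDeriv h (Icc (0 : ℝ) 1 ∩ U) t q := by
    intro t
    by_cases ht : t ∈ Icc (0 : ℝ) 1 ∩ U
    · exact ⟨_, fun _ => HasVel.hasLogDeriv
        (hasVel_of_mdifferentiableWithinAt ((hhs t ht).mdifferentiableWithinAt (by simp)))⟩
    · exact ⟨0, fun h => absurd h ht⟩
  choose η hη using hex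
  have hηs : ContDiffWithinAt ℝ ∞ η (Icc 0 1) t₀ :=
    contDiffWithinAt_logDeriv hU ⟨ht₀, ht₀U⟩ hhs hη
  -- `Pr` is the projection onto `𝔪` along `𝔥`. As `c = h . eH` locally, its velocity is induced by
  -- `η`, so `θ_ω(ċ) = Ad(h) Pr Ad(h⁻¹) η`, visibly smooth.
  set Pr : E →L[ℝ] E := omegaE (F := F) H 𝔪 ∘L tangentProj E F H with hPr
  have hval : ∀ t ∈ Icc (0 : ℝ) 1 ∩ U,
      IccExtend zero_le_one (thetaD 𝔪 c) t = Ad (h t) (Pr (Ad (h t)⁻¹ (η t))) := by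
    intro t ht
    have e : IccExtend zero_le_one (thetaD 𝔪 c) t = thetaD 𝔪 c ⟨t, ht.1⟩ := by
      simp [IccExtend, projIcc_of_mem zero_le_one ht.1]
    have e2 : ĉ t = c ⟨t, ht.1⟩ := by
      simp [hĉ, IccExtend, projIcc_of_mem zero_le_one ht.1]
    have hv1 : HasVel (F := F) ĉ (Icc 0 1 ∩ U) t (velocity (F := F) c ⟨t, ht.1⟩ : F) :=
      HasVel.mono (SmoothCurve.hasVel c ⟨t, ht.1⟩) inter_subset_left
    have hv2 := HasLogDeriv.hasVel_smul hπ ((1 : G) : G ⧸ H) (hη t ht)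
    have e3 : ∀ k : G, k • ((1 : G) : G ⧸ H) = (k : G ⧸ H) := fun k => by
      rw [MulAction.Quotient.smul_coe, smul_eq_mul, mul_one]
    simp only [e3] at hv2
    rw [hhc t ht] at hv2
    have hv3 := HasVel.congr hv2 (fun y hy => (hhc y hy).symm) (hhc t ht).symm
    have hv4 := HasVel.unique (F := F) (hUD t ht) hv1 hv3
    rw [e, thetaD, hv4, ← e2, omega_eq_omegaAt hπ h𝔪 (hhc t ht), omegaAt_orbitT hπ (hhc t ht)]
    rfl
  have ht₀m : t₀ ∈ Icc (0 : ℝ) 1 ∩ U := ⟨ht₀, ht₀U⟩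
  have hnhds : Icc (0 : ℝ) 1 ∩ U ∈ 𝓝[Icc 0 1] t₀ :=
    Filter.inter_mem self_mem_nhdsWithin (mem_nhdsWithin_of_mem_nhds (hU.mem_nhds ht₀U))
  have hA1 : ContDiffWithinAt ℝ ∞ (fun t => (Ad (h t) : E →L[ℝ] E)) (Icc 0 1 ∩ U) t₀ :=
    contMDiffWithinAt_iff_contDiffWithinAt.1
      (contMDiff_Ad.contMDiffAt.comp_contMDiffWithinAt t₀ (hhs t₀ ht₀m))
  have hA2 : ContDiffWithinAt ℝ ∞ (fun t => (Ad (h t)⁻¹ : E →L[ℝ] E)) (Icc 0 1 ∩ U) t₀ :=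
    contMDiffWithinAt_iff_contDiffWithinAt.1
      (contMDiff_Ad.contMDiffAt.comp_contMDiffWithinAt t₀ (hhs t₀ ht₀m).inv)
  have hfin := hA1.clm_apply (Pr.contDiff.contDiffAt.comp_contDiffWithinAt t₀
    (hA2.clm_apply (hηs.mono inter_subset_left)))
  exact (hfin.congr hval (hval t₀ ht₀m)).mono_of_mem_nhdsWithin hnhds

end Omega
end Action

/-! ### The algebra of `Ψ` and its image -/

section Psi

variable {E : Type*} [NormedAddCommGroup E] [NormedSpace ℝ E] [FiniteDimensional ℝ E]
  {G : Type*} [TopologicalSpace G] [ChartedSpace E G] [Group G] [LieGroup 𝓘(ℝ, E) ∞ G]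

theorem extend_coe {α : Type*} (f : unitInterval → α) (t : unitInterval) :
    IccExtend zero_le_one f (t : ℝ) = f t := by simp [IccExtend]

variable (G) in
/-- The evolution of `q`, extended to a map on `ℝ`. -/
def evol (q : SmoothCurve E E) : ℝ → G := IccExtend zero_le_one (Evol q : SmoothCurve E G)

theorem evol_coe (q : SmoothCurve E E) (t : unitInterval) :
    evol G q t = Evol q t := extend_coe _ _

theorem evol_zero (q : SmoothCurve E E) : evol G q 0 = 1 :=
  (evol_coe q 0).trans (isEvolution_Evol q).1

theorem hasLogDeriv_evol (q : SmoothCurve E E) {t : ℝ} (ht : t ∈ Icc (0 : ℝ) 1) :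
    HasLogDeriv (evol G q) (Icc (0 : ℝ) 1) t (IccExtend zero_le_one q t) := by
  have := ((isEvolution_iff q _).1 (isEvolution_Evol (G := G) q)).2 ⟨t, ht⟩
  rwa [← extend_coe q ⟨t, ht⟩] at this

theorem Psi_apply (g₀ : G) (q : SmoothCurve E E) (t : unitInterval) :
    Psi g₀ q t = -(Ad (g₀ * (evol G q t)⁻¹) (q t)) := by
  rw [evol_coe]; rfl

/-- The right-hand side starts at the identity and has logarithmic derivative `Ad(g₀)(-Ad(Evol(q)⁻¹)
q)`, which is `Ψ_{g₀}(q)`. -/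
theorem evol_Psi (g₀ : G) (q : SmoothCurve E E) {t : ℝ} (ht : t ∈ Icc (0 : ℝ) 1) :
    evol G (Psi g₀ q) t = g₀ * (evol G q t)⁻¹ * g₀⁻¹ := by
  refine eq_of_hasLogDeriv (fun t ht => hasLogDeriv_evol (Psi g₀ q) ht)
    (d := fun t => g₀ * (evol G q t)⁻¹ * g₀⁻¹) (fun t ht => ?_) ?_ ht
  · have h := ((((hasLogDeriv_evol (G := G) q ht).inv
      (uniqueDiffOn_Icc_zero_one t ht)).comp_const_mul g₀).comp_mul_const g₀⁻¹)
    have e : IccExtend zero_le_one (Psi g₀ q) t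
        = Ad g₀ (-(Ad (evol G q t)⁻¹ (IccExtend zero_le_one q t))) := by
      have := Psi_apply g₀ q ⟨t, ht⟩
      rw [← extend_coe (Psi g₀ q) ⟨t, ht⟩, ← extend_coe q ⟨t, ht⟩] at this
      rw [this, Ad_mul_apply, map_neg]
    rw [e]
    exact h
  · simp [evol_zero]

theorem Psi_inv_Psi (g₀ : G) (q : SmoothCurve E E) : Psi g₀⁻¹ (Psi g₀ q) = q := by
  ext t
  rw [Psi_apply, evol_Psi g₀ q t.2, Psi_apply, map_neg, neg_neg, ← Ad_mul_apply]
  have : g₀⁻¹ * (g₀ * (evol G q t)⁻¹ * g₀⁻¹)⁻¹ * (g₀ * (evol G q t)⁻¹) = 1 := by group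
  rw [this, Ad_one]; rfl

theorem Psi_Psi_inv (g₀ : G) (q : SmoothCurve E E) : Psi g₀ (Psi g₀⁻¹ q) = q := by
  have := Psi_inv_Psi g₀⁻¹ q
  rwa [inv_inv] at this

variable {F : Type*} [NormedAddCommGroup F] [NormedSpace ℝ F]
  {H : Subgroup G} [ChartedSpace F (G ⧸ H)] [IsManifold 𝓘(ℝ, F) ∞ (G ⧸ H)]
  {𝔪 : Submodule ℝ E}

theorem velocity_rho
    (hπ : Manifold.IsSubmersion 𝓘(ℝ, E) 𝓘(ℝ, F) ∞ (QuotientGroup.mk : G → G ⧸ H))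
    (c₀ : G ⧸ H) (p : SmoothCurve E E) (t : unitInterval) :
    (velocity (F := F) (rho hπ c₀ p) t : F) = orbitT E F (rho hπ c₀ p t) (p t) := by
  have h := HasLogDeriv.hasVel_smul hπ c₀ (hasLogDeriv_evol (G := G) p t.2)
  rw [extend_coe] at h
  have h2 := velocity_eq_of_hasVel' h
  have e : (fun t : unitInterval => evol G p t • c₀) = rho hπ c₀ p := by
    funext t; rw [evol_coe]; rfl
  rw [e, evol_coe] at h2
  exact h2

/-- The factor `g₀⁻¹` in `evol_Psi` cancels against the representative `g₀` of the initial point.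
The resulting lift is the very element whose `Ad` occurs in `Ψ`. -/
theorem rho_Psi_apply
    (hπ : Manifold.IsSubmersion 𝓘(ℝ, E) 𝓘(ℝ, F) ∞ (QuotientGroup.mk : G → G ⧸ H))
    (g₀ : G) (q : SmoothCurve E E) (t : unitInterval) :
    ((g₀ * (evol G q t)⁻¹ : G) : G ⧸ H) = rho hπ (g₀ : G ⧸ H) (Psi g₀ q) t := by
  change _ = (Evol (Psi g₀ q) t : G) • (g₀ : G ⧸ H)
  rw [← evol_coe, evol_Psi g₀ q t.2, MulAction.Quotient.smul_coe, smul_eq_mul,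
    inv_mul_cancel_right]

/-- With `k = g₀ Evol(q)⁻¹` the velocity is induced by `Ad(k)(-q)`, where `-q ∈ 𝔪` and `k`
represents the point; `ω` returns exactly this vector. -/
theorem thetaD_rho_Psi
    (hπ : Manifold.IsSubmersion 𝓘(ℝ, E) 𝓘(ℝ, F) ∞ (QuotientGroup.mk : G → G ⧸ H))
    (h𝔪 : IsReductiveComplement H 𝔪) (g₀ : G) (q : SmoothCurve E E) (hq : ∀ t, q t ∈ 𝔪) :
    thetaD 𝔪 (rho hπ (g₀ : G ⧸ H) (Psi g₀ q)) = Psi g₀ q := by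
  funext t
  have hx := rho_Psi_apply hπ g₀ q t
  have e : Psi g₀ q t = Ad (g₀ * (evol G q t)⁻¹) (-(q t)) := by rw [Psi_apply, map_neg]
  rw [thetaD, velocity_rho, omega_eq_omegaAt hπ h𝔪 hx, e]
  exact omegaAt_orbitT_Ad hπ h𝔪.1 hx (neg_mem (hq t))

theorem omega_zero (x : G ⧸ H) : omega 𝔪 x (0 : F) = (0 : E) := by
  change Ad _ (omegaE (F := F) H 𝔪 ((tmap (fun y : G ⧸ H => x.out⁻¹ • y) x : F →L[ℝ] F) 0)) = 0
  rw [map_zero, map_zero, map_zero]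

theorem isImm_rho_Psi
    (hπ : Manifold.IsSubmersion 𝓘(ℝ, E) 𝓘(ℝ, F) ∞ (QuotientGroup.mk : G → G ⧸ H))
    (h𝔪 : IsReductiveComplement H 𝔪) (g₀ : G) (q : SmoothCurve E E)
    (hq : ∀ t, q t ∈ 𝔪 ∧ q t ≠ 0) : IsImm (F := F) (rho hπ (g₀ : G ⧸ H) (Psi g₀ q)) := by
  intro t h0
  have h1 := congrFun (thetaD_rho_Psi hπ h𝔪 g₀ q fun t => (hq t).1) t
  rw [thetaD, h0] at h1
  have h2 : Psi g₀ q t = 0 := h1.symm.trans (omega_zero (F := F) _)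
  rw [Psi_apply, neg_eq_zero] at h2
  have h3 := congrArg (Ad (E := E) (g₀ * (evol G q t)⁻¹)⁻¹) h2
  rw [Ad_inv_apply_Ad, map_zero] at h3
  exact (hq t).2 h3

/-- A curve `c` is recovered from `θ_ω(ċ)` and its initial point. -/
theorem evol_smul_eq
    (hπ : Manifold.IsSubmersion 𝓘(ℝ, E) 𝓘(ℝ, F) ∞ (QuotientGroup.mk : G → G ⧸ H))
    (h𝔪 : IsReductiveComplement H 𝔪) (c : SmoothCurve F (G ⧸ H)) (f : SmoothCurve E E)
    (hf : ∀ t, f t = thetaD 𝔪 c t) (t : unitInterval) : evol G f t • c 0 = c t := by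
  have : IsManifold 𝓘(ℝ, F) 1 (G ⧸ H) := IsManifold.of_le (n := ∞) (by simp)
  have hv : ∀ t ∈ Icc (0 : ℝ) 1,
      HasVel (F := F) (fun τ => (evol G f τ)⁻¹ • IccExtend zero_le_one c τ) (Icc 0 1) t 0 := by
    intro t ht
    have h1 := (hasLogDeriv_evol (G := G) f ht).inv (uniqueDiffOn_Icc_zero_one t ht)
    have h2 : HasVel (F := F) (IccExtend zero_le_one c) (Icc (0 : ℝ) 1) t
        (orbitT E F (IccExtend zero_le_one c t) (IccExtend zero_le_one f t)) := by
      have h3 : HasVel (F := F) (IccExtend zero_le_one c) (Icc (0 : ℝ) 1) t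
        (velocity (F := F) c ⟨t, ht⟩) := SmoothCurve.hasVel c ⟨t, ht⟩
      have e1 : IccExtend zero_le_one c t = c ⟨t, ht⟩ := extend_coe c ⟨t, ht⟩
      have e2 : IccExtend zero_le_one f t = thetaD 𝔪 c ⟨t, ht⟩ :=
        (extend_coe f ⟨t, ht⟩).trans (hf _)
      have e3 : orbitT E F (IccExtend zero_le_one c t) (IccExtend zero_le_one f t)
          = (velocity (F := F) c ⟨t, ht⟩ : F) := by
        rw [e1, e2]; exact orbitT_omega hπ h𝔪 _ _
      rw [e3]
      exact h3
    -- The two contributions are `-Ad(Evol(f)⁻¹) f` and `Ad(Evol(f)⁻¹) f`, so `Evol(f)⁻¹ . c` stands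
    -- still.
    have h4 := HasVel.smul hπ h1 h2
    rwa [neg_add_cancel, map_zero] at h4
  have h := eq_of_hasVel_zero hv t.2
  rw [evol_zero, inv_one, one_smul, extend_coe] at h
  have e0 : IccExtend zero_le_one c (0 : ℝ) = c 0 := extend_coe c 0
  rw [e0, inv_smul_eq_iff] at h
  exact h.symm

theorem image_Psi_eq
    (hπ : Manifold.IsSubmersion 𝓘(ℝ, E) 𝓘(ℝ, F) ∞ (QuotientGroup.mk : G → G ⧸ H))
    (h𝔪 : IsReductiveComplement H 𝔪) (g₀ : G) :
    (fun q : SmoothCurve E E => (Psi g₀ q : unitInterval → E)) ''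
        {q : SmoothCurve E E | ∀ t, q t ∈ 𝔪 ∧ q t ≠ 0}
      = {f : unitInterval → E | ∃ c : SmoothCurve F (G ⧸ H), IsImm c ∧ c 0 = (g₀ : G ⧸ H) ∧
          f = thetaD 𝔪 c} := by
  apply Subset.antisymm
  · rintro _ ⟨q, hq, rfl⟩
    refine ⟨rho hπ (g₀ : G ⧸ H) (Psi g₀ q), isImm_rho_Psi hπ h𝔪 g₀ q hq, ?_,
      (thetaD_rho_Psi hπ h𝔪 g₀ q fun t => (hq t).1).symm⟩
    change (Evol (Psi g₀ q) 0 : G) • (g₀ : G ⧸ H) = _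
    rw [(isEvolution_Evol (Psi g₀ q)).1, one_smul]
  · rintro _ ⟨c, hc, hc0, rfl⟩
    let f : SmoothCurve E E := ⟨thetaD 𝔪 c, contMDiff_thetaD hπ h𝔪 c⟩
    have hf : ∀ t, f t = thetaD 𝔪 c t := fun _ => rfl
    refine ⟨Psi g₀⁻¹ f, fun t => ?_, ?_⟩
    · have hx := evol_smul_eq hπ h𝔪 c f hf t
      -- This lift of `c` has the inverse that occurs in `Ψ_{g₀⁻¹}(f)`; pulling `ω(ċ)` back by it
      -- lands in `𝔪`.
      have hrep : ((evol G f t * g₀ : G) : G ⧸ H) = c t := by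
        rw [← hx, hc0]; rfl
      have e : Psi g₀⁻¹ f t = -(Ad (evol G f t * g₀)⁻¹ (thetaD 𝔪 c t)) := by
        rw [Psi_apply, hf, mul_inv_rev]
      rw [e]
      refine ⟨neg_mem (Ad_inv_omega_mem hπ h𝔪 hrep _), fun h0 => hc t ?_⟩
      rw [neg_eq_zero] at h0
      have h1 := congrArg (Ad (E := E) (evol G f t * g₀)) h0
      rw [Ad_apply_Ad_inv, map_zero] at h1
      have h2 := orbitT_omega hπ h𝔪 (c t) (velocity (F := F) c t)
      have h3 : omega 𝔪 (c t) (velocity (F := F) c t) = 0 := h1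
      rw [h3, map_zero] at h2
      exact h2.symm
    · change ⇑(Psi g₀ (Psi g₀⁻¹ f)) = _
      rw [Psi_Psi_inv]; rfl

end Psi

/-! ### Calculus of directional derivatives and Bastiani smoothness -/

section Bastiani

universe u v
variable {Y : Type v} [AddCommGroup Y] [Module ℝ Y] [TopologicalSpace Y]

/-- `f'` is the directional derivative of `f`. -/
def HasDirDeriv {X : Type u} [AddCommGroup X] [Module ℝ X] (f : X → Y) (f' : X × X → Y) : Prop :=
  ∀ x w : X, Filter.Tendsto (fun s : ℝ => s⁻¹ • (f (x + s • w) - f x)) (𝓝[≠] 0) (𝓝 (f' (x, w)))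

/-- `f` is `n` times continuously differentiable, in the sense that `f` is continuous and its
directional derivative `X × X → Y` is `n - 1` times continuously differentiable. -/
def DirContDiff : ℕ → ∀ {X : Type u} [AddCommGroup X] [Module ℝ X] [TopologicalSpace X],
    (X → Y) → Prop
  | 0, _, _, _, _, f => Continuous f
  | n + 1, X, _, _, _, f =>
    Continuous f ∧ ∃ f' : X × X → Y, HasDirDeriv f f' ∧ DirContDiff n f'

section

variable {X : Type u} [AddCommGroup X] [Module ℝ X] [TopologicalSpace X]
  {X' : Type u} [AddCommGroup X'] [Module ℝ X'] [TopologicalSpace X']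

theorem DirContDiff.of_succ {n : ℕ} {X : Type u} [AddCommGroup X] [Module ℝ X]
    [TopologicalSpace X] {f : X → Y} (h : DirContDiff (n + 1) f) : DirContDiff n f := by
  induction n generalizing X with
  | zero => exact h.1
  | succ n ih =>
    obtain ⟨hc, f', hf', h'⟩ := h
    exact ⟨hc, f', hf', ih h'⟩

theorem DirContDiff.comp_linear {n : ℕ} {X X' : Type u} [AddCommGroup X] [Module ℝ X]
    [TopologicalSpace X] [AddCommGroup X'] [Module ℝ X'] [TopologicalSpace X'] {f : X → Y}
    (h : DirContDiff n f) (L : X' →L[ℝ] X) : DirContDiff n fun x => f (L x) := by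
  induction n generalizing X X' with
  | zero => exact Continuous.comp h L.continuous
  | succ n ih =>
    obtain ⟨hc, f', hf', h'⟩ := h
    refine ⟨hc.comp L.continuous, fun p => f' (L p.1, L p.2), fun x w => ?_, ?_⟩
    · have := hf' (L x) (L w)
      simpa only [map_add, map_smul] using this
    · exact ih h' (L.prodMap L)

theorem DirContDiff.linear_comp {n : ℕ} {Z : Type*} [AddCommGroup Z] [Module ℝ Z]
    [TopologicalSpace Z] {X : Type u} [AddCommGroup X] [Module ℝ X]
    [TopologicalSpace X] {f : X → Y} (h : DirContDiff n f) (L : Y →L[ℝ] Z) :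
    DirContDiff n fun x => L (f x) := by
  induction n generalizing X with
  | zero => exact L.continuous.comp h
  | succ n ih =>
    obtain ⟨hc, f', hf', h'⟩ := h
    refine ⟨L.continuous.comp hc, fun p => L (f' p), fun x w => ?_, ih h'⟩
    have := (L.continuous.tendsto _).comp (hf' x w)
    refine this.congr fun s => ?_
    simp only [Function.comp_apply, map_smul, map_sub]

theorem dirContDiff_linear (n : ℕ) {X : Type u} [AddCommGroup X] [Module ℝ X]
    [TopologicalSpace X] (L : X →L[ℝ] Y) : DirContDiff n fun x => L x := by
  induction n generalizing X with
  | zero => exact L.continuous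
  | succ n ih =>
    refine ⟨L.continuous, fun p => L p.2, fun x w => ?_, ih (L ∘L ContinuousLinearMap.snd ℝ X X)⟩
    refine tendsto_const_nhds.congr' ?_
    filter_upwards [self_mem_nhdsWithin] with s hs
    simp only [map_add, map_smul, add_sub_cancel_left]
    rw [smul_smul, inv_mul_cancel₀ hs, one_smul]

theorem DirContDiff.add [IsTopologicalAddGroup Y] {n : ℕ} {X : Type u} [AddCommGroup X]
    [Module ℝ X] [TopologicalSpace X] {f g : X → Y} (hf : DirContDiff n f)
    (hg : DirContDiff n g) : DirContDiff n fun x => f x + g x := by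
  induction n generalizing X with
  | zero => exact Continuous.add hf hg
  | succ n ih =>
    obtain ⟨hfc, f', hf', hfn⟩ := hf
    obtain ⟨hgc, g', hg', hgn⟩ := hg
    refine ⟨hfc.add hgc, fun p => f' p + g' p, fun x w => ?_, ih hfn hgn⟩
    refine ((hf' x w).add (hg' x w)).congr fun s => ?_
    rw [← smul_add, add_sub_add_comm]

theorem DirContDiff.bilinear {Z W : Type*} [AddCommGroup Z] [Module ℝ Z] [TopologicalSpace Z]
    [AddCommGroup W] [Module ℝ W] [TopologicalSpace W] [IsTopologicalAddGroup W]
    {n : ℕ} {X : Type u} [AddCommGroup X] [Module ℝ X] [TopologicalSpace X]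
    [IsTopologicalAddGroup X] [ContinuousSMul ℝ X] (b : Y →ₗ[ℝ] Z →ₗ[ℝ] W)
    (hb : Continuous fun p : Y × Z => b p.1 p.2) {f : X → Y} {g : X → Z}
    (hf : DirContDiff n f) (hg : DirContDiff n g) : DirContDiff n fun x => b (f x) (g x) := by
  induction n generalizing X with
  | zero => exact hb.comp (Continuous.prodMk hf hg)
  | succ n ih =>
    have hf₀ := hf.of_succ
    have hg₀ := hg.of_succ
    obtain ⟨hfc, f', hf', hfn⟩ := hf
    obtain ⟨hgc, g', hg', hgn⟩ := hg
    refine ⟨hb.comp (hfc.prodMk hgc), fun p => b (f' p) (g p.1) + b (f p.1) (g' p),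
      fun x w => ?_, ?_⟩
    · have hx : Filter.Tendsto (fun s : ℝ => x + s • w) (𝓝[≠] 0) (𝓝 x) := by
        have h1 : Continuous fun s : ℝ => x + s • w := by fun_prop
        have h2 := h1.tendsto 0
        rw [zero_smul, add_zero] at h2
        exact h2.mono_left nhdsWithin_le_nhds
      -- Leibniz splitting: increment of `f` paired with the shifted `g`, plus `f x` paired with the
      -- increment of `g`.
      have h1 : Filter.Tendsto (fun s : ℝ => b (s⁻¹ • (f (x + s • w) - f x)) (g (x + s • w)))
          (𝓝[≠] 0) (𝓝 (b (f' (x, w)) (g x))) :=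
        (hb.tendsto (f' (x, w), g x)).comp
          ((hf' x w).prodMk_nhds ((hgc.tendsto x).comp hx))
      have h2 : Filter.Tendsto (fun s : ℝ => b (f x) (s⁻¹ • (g (x + s • w) - g x)))
          (𝓝[≠] 0) (𝓝 (b (f x) (g' (x, w)))) :=
        (hb.tendsto (f x, g' (x, w))).comp (tendsto_const_nhds.prodMk_nhds (hg' x w))
      refine (h1.add h2).congr fun s => ?_
      simp only [map_smul, map_sub, LinearMap.smul_apply, LinearMap.sub_apply]
      rw [← smul_add]; congr 1; abel
    · exact (ih hfn (hg₀.comp_linear (ContinuousLinearMap.fst ℝ X X))).add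
        (ih (hf₀.comp_linear (ContinuousLinearMap.fst ℝ X X)) hgn)

end

/-- `f` has directional derivatives of all orders. -/
def DirSmooth {X : Type u} [AddCommGroup X] [Module ℝ X] [TopologicalSpace X] (f : X → Y) : Prop :=
  ∀ n, DirContDiff n f

variable {X : Type u} [AddCommGroup X] [Module ℝ X] [TopologicalSpace X]

/-- Each order supplies its own derivative; uniqueness of limits identifies them, so one map serves
for all orders. -/
theorem DirSmooth.exists_deriv [T2Space Y] {f : X → Y} (h : DirSmooth f) :
    ∃ f' : X × X → Y, HasDirDeriv f f' ∧ DirSmooth f' := by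
  obtain ⟨-, f', hf', -⟩ := h 1
  refine ⟨f', hf', fun n => ?_⟩
  obtain ⟨-, g, hg, hgn⟩ := h (n + 1)
  have : g = f' := by
    funext p
    exact tendsto_nhds_unique (hg p.1 p.2) (hf' p.1 p.2)
  rwa [← this]

/-- The linear map `(x, v) ↦ ((x, v₁, …, vₖ), (vₖ₊₁, 0))`. -/
def splitLast (X : Type u) [AddCommGroup X] [Module ℝ X] [TopologicalSpace X] (k : ℕ) :
    (X × (Fin (k + 1) → X)) →L[ℝ] (X × (Fin k → X)) × (X × (Fin k → X)) where
  toFun p := ((p.1, Fin.init (α := fun _ => X) p.2), (p.2 (Fin.last k), 0))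
  map_add' p q := by ext <;> simp [Fin.init]
  map_smul' r p := by ext <;> simp [Fin.init]
  cont := by
    change Continuous fun p : X × (Fin (k + 1) → X) =>
      ((p.1, fun i : Fin k => p.2 i.castSucc), (p.2 (Fin.last k), (0 : Fin k → X)))
    fun_prop

/-- The iterated directional derivatives of a smooth map. -/
def DirSmooth.iter [T2Space Y] {f : X → Y} (h : DirSmooth f) :
    (k : ℕ) → {φ : X × (Fin k → X) → Y // DirSmooth φ}
  | 0 => ⟨fun p => f p.1, fun n => (h n).comp_linear (ContinuousLinearMap.fst ℝ X (Fin 0 → X))⟩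
  -- Bastiani's iterated derivatives keep earlier directions fixed, so the map on `(x, v)` is
  -- differentiated in the direction `(w, 0)` only.
  | k + 1 => ⟨fun p => (h.iter k).2.exists_deriv.choose (splitLast X k p), fun n =>
      ((h.iter k).2.exists_deriv.choose_spec.2 n).comp_linear (splitLast X k)⟩

theorem DirSmooth.bastianiSmooth [T2Space Y] {f : X → Y} (h : DirSmooth f) :
    BastianiSmooth f := by
  refine ⟨fun k x v => (h.iter k).1 (x, v), fun x v => rfl, fun k => ((h.iter k).2 0), ?_⟩
  intro k x v w
  have h1 := (h.iter k).2.exists_deriv.choose_spec.1 (x, v) (w, 0)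
  have hs : ∀ s : ℝ, ((x, v) : X × (Fin k → X)) + s • (w, 0) = (x + s • w, v) := fun s => by
    ext <;> simp
  have e : (h.iter (k + 1)).1 (x, Fin.snoc (α := fun _ => X) v w)
      = (h.iter k).2.exists_deriv.choose ((x, v), (w, 0)) := by
    change (h.iter k).2.exists_deriv.choose
      ((x, Fin.init (α := fun _ => X) (Fin.snoc (α := fun _ => X) v w)),
        ((Fin.snoc (α := fun _ => X) v w : Fin (k + 1) → X) (Fin.last k), 0)) = _
    rw [Fin.init_snoc, Fin.snoc_last]
  beta_reduce
  rw [e]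
  exact h1.congr fun s => by rw [hs]

end Bastiani

/-! ### The topology of smooth curves, products and antiderivatives -/

section Frechet

variable {V : Type*} [NormedAddCommGroup V] [NormedSpace ℝ V]
  {V₁ : Type*} [NormedAddCommGroup V₁] [NormedSpace ℝ V₁]
  {V₂ : Type*} [NormedAddCommGroup V₂] [NormedSpace ℝ V₂]
  {V₃ : Type*} [NormedAddCommGroup V₃] [NormedSpace ℝ V₃]

theorem extend_of_mem {α : Type*} (f : unitInterval → α) {t : ℝ} (ht : t ∈ Icc (0 : ℝ) 1) :
    IccExtend zero_le_one f t = f ⟨t, ht⟩ := extend_coe f ⟨t, ht⟩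

/-- The derivative of a smooth curve in a normed space. -/
def derivCurve (f : SmoothCurve V V) : SmoothCurve V V :=
  SmoothCurve.ofReal (derivWithin (IccExtend zero_le_one f) (Icc (0 : ℝ) 1))
    ((contDiffOn_infty_iff_derivWithin uniqueDiffOn_Icc_zero_one).1
      f.contDiffOn_extend).2.contMDiffOn

theorem hasDerivWithinAt_extend (f : SmoothCurve V V) {t : ℝ} (ht : t ∈ Icc (0 : ℝ) 1) :
    HasDerivWithinAt (IccExtend zero_le_one f) (IccExtend zero_le_one (derivCurve f) t)
      (Icc (0 : ℝ) 1) t := by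
  rw [extend_of_mem _ ht]
  exact ((f.contDiffOn_extend.differentiableOn (by simp)) t ht).hasDerivWithinAt

theorem derivCurve_eq {f g : SmoothCurve V V}
    (h : ∀ t ∈ Icc (0 : ℝ) 1, HasDerivWithinAt (IccExtend zero_le_one f)
      (IccExtend zero_le_one g t) (Icc (0 : ℝ) 1) t) : derivCurve f = g := by
  ext t
  rw [← extend_coe g]
  exact (h t t.2).derivWithin (uniqueDiffWithinAt_unit t)

theorem curveDeriv_succ (k : ℕ) (f : SmoothCurve V V) :
    curveDeriv (k + 1) f = curveDeriv k (derivCurve f) := by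
  funext t
  rw [curveDeriv, curveDeriv, iteratedDerivWithin_succ']
  refine iteratedDerivWithin_congr (fun s hs => ?_) t.2
  rw [extend_of_mem _ hs]
  rfl

theorem curveDeriv_eq (k : ℕ) (f : SmoothCurve V V) : curveDeriv k f = derivCurve^[k] f := by
  induction k generalizing f with
  | zero => funext t; simp [curveDeriv]
  | succ k ih => rw [curveDeriv_succ, ih, Function.iterate_succ_apply]

variable (V) in
/-- The inclusion of the smooth curves in the continuous curves. -/
def toCont : SmoothCurve V V →ₗ[ℝ] C(unitInterval, V) where
  toFun f := ⟨f, f.contMDiff.continuous⟩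
  map_add' _ _ := rfl
  map_smul' _ _ := rfl

variable (V) in
theorem derivCurve_add_smul (a : ℝ) (f g : SmoothCurve V V) :
    derivCurve (f + a • g) = derivCurve f + a • derivCurve g :=
  derivCurve_eq fun t ht => by
    have := (hasDerivWithinAt_extend f ht).add ((hasDerivWithinAt_extend g ht).const_smul a)
    exact this

variable (V) in
/-- The derivative, as a linear map. -/
def derivL : SmoothCurve V V →ₗ[ℝ] SmoothCurve V V where
  toFun := derivCurve
  map_add' f g := by simpa using derivCurve_add_smul V 1 f g
  map_smul' a f := by
    have h0 : derivCurve (0 : SmoothCurve V V) = 0 :=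
      derivCurve_eq fun _ _ => hasDerivWithinAt_const _ _ (0 : V)
    simpa [h0] using derivCurve_add_smul V a 0 f

variable (V) in
/-- The family of all derivatives of a smooth curve. -/
def jets : SmoothCurve V V →ₗ[ℝ] (ℕ → C(unitInterval, V)) :=
  LinearMap.pi fun k => toCont V ∘ₗ (derivL V) ^ k

theorem jets_apply (f : SmoothCurve V V) (k : ℕ) : jets V f k = toCont V (derivCurve^[k] f) := by
  simp only [jets, LinearMap.pi_apply, LinearMap.comp_apply, Module.End.pow_apply]
  rfl

/-- On the compact interval, uniform convergence of continuous curves is the topology of `C(I, V)`.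
The vector space and separation axioms are then inherited from a product of such spaces. -/
theorem isInducing_jets : Topology.IsInducing (jets V) := by
  have h1 : Topology.IsInducing
      (fun f : C(unitInterval, V) => UniformFun.ofFun (f : unitInterval → V)) :=
    (BoundedContinuousFunction.isInducing_coeFn (α := unitInterval) (β := V)).comp
      (ContinuousMap.isUniformInducing_equivBoundedOfCompact unitInterval V).isInducing
  constructor
  change (⨅ k : ℕ, _) = _
  rw [Pi.topologicalSpace, induced_iInf]
  refine iInf_congr fun k => ?_
  rw [induced_compose, h1.eq_induced, induced_compose]
  congr 1
  funext f
  simp only [Function.comp_apply]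
  rw [jets_apply, curveDeriv_eq]
  rfl

theorem jets_injective : Function.Injective (jets V) := fun f g h => by
  have := congrFun h 0
  rw [jets_apply, jets_apply] at this
  ext t
  exact congrArg (fun φ : C(unitInterval, V) => φ t) this

instance : IsTopologicalAddGroup (SmoothCurve V V) := by
  have := isInducing_jets (V := V)
  exact this.topologicalAddGroup (jets V)

instance : ContinuousSMul ℝ (SmoothCurve V V) :=
  isInducing_jets.continuousSMul continuous_id (map_smul (jets V) _ _)

instance : T2Space (SmoothCurve V V) :=
  T2Space.of_injective_continuous jets_injective isInducing_jets.continuous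

/-- Continuity of a family of smooth curves together with its derivatives of order `≤ k`. -/
def ContCurve {Z : Type*} [TopologicalSpace Z] (k : ℕ) (Φ : Z → SmoothCurve V V) : Prop :=
  ∀ j ≤ k, Continuous fun z => toCont V (derivCurve^[j] (Φ z))

section ContCurve

variable {Z : Type*} [TopologicalSpace Z]

theorem continuous_iff_contCurve {Φ : Z → SmoothCurve V V} :
    Continuous Φ ↔ ∀ k, ContCurve k Φ := by
  rw [isInducing_jets.continuous_iff, continuous_pi_iff]
  simp only [Function.comp_apply, jets_apply]
  exact ⟨fun h k j _ => h j, fun h k => h k k le_rfl⟩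

theorem contCurve_zero_iff {Φ : Z → SmoothCurve V V} :
    ContCurve 0 Φ ↔ Continuous fun z => toCont V (Φ z) := by
  simp [ContCurve]

/-- Makes continuity provable by induction on the order when `derivCurve (Φ z)` is given by a
formula such as a differential equation. -/
theorem contCurve_succ_iff {k : ℕ} {Φ : Z → SmoothCurve V V} :
    ContCurve (k + 1) Φ ↔ ContCurve 0 Φ ∧ ContCurve k fun z => derivCurve (Φ z) := by
  constructor
  · intro h
    refine ⟨fun j hj => h j (by omega), fun j hj => ?_⟩
    have := h (j + 1) (by omega)
    simpa only [Function.iterate_succ_apply] using this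
  · rintro ⟨h0, h1⟩ j hj
    cases j with
    | zero => exact h0 0 le_rfl
    | succ j =>
      have := h1 j (by omega)
      simpa only [Function.iterate_succ_apply] using this

theorem ContCurve.congr {k : ℕ} {Φ Ψ : Z → SmoothCurve V V} (h : ContCurve k Φ)
    (e : ∀ z, Φ z = Ψ z) : ContCurve k Ψ := by
  rwa [← funext e]

theorem ContCurve.of_succ {k : ℕ} {Φ : Z → SmoothCurve V V} (h : ContCurve (k + 1) Φ) :
    ContCurve k Φ := fun j hj => h j (by omega)

theorem ContCurve.add {k : ℕ} {Φ Ψ : Z → SmoothCurve V V} (hΦ : ContCurve k Φ)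
    (hΨ : ContCurve k Ψ) : ContCurve k fun z => Φ z + Ψ z := fun j hj => by
  have := (hΦ j hj).add (hΨ j hj)
  have e : ∀ f : SmoothCurve V V, derivCurve^[j] f = ((derivL V) ^ j) f := fun f => by
    rw [Module.End.pow_apply]; rfl
  simp only [e, map_add] at this ⊢
  exact this

end ContCurve

/-- The pointwise product of two smooth curves under a bilinear map. -/
def bilinCurve (β : V₁ →L[ℝ] V₂ →L[ℝ] V₃) :
    SmoothCurve V₁ V₁ →ₗ[ℝ] SmoothCurve V₂ V₂ →ₗ[ℝ] SmoothCurve V₃ V₃ :=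
  LinearMap.mk₂ ℝ
    (fun f g => ⟨fun t => β (f t) (g t),
      ((β.contDiff.contMDiff (n := ∞)).comp f.contMDiff).clm_apply g.contMDiff⟩)
    (fun f f' g => by ext t; exact β.map_add₂ _ _ _)
    (fun a f g => by ext t; exact β.map_smul₂ _ _ _)
    (fun f g g' => by ext t; exact (β (f t)).map_add _ _)
    (fun a f g => by ext t; exact (β (f t)).map_smul _ _)

theorem derivCurve_bilinCurve (β : V₁ →L[ℝ] V₂ →L[ℝ] V₃) (f : SmoothCurve V₁ V₁)
    (g : SmoothCurve V₂ V₂) :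
    derivCurve (bilinCurve β f g)
      = bilinCurve β f (derivCurve g) + bilinCurve β (derivCurve f) g :=
  derivCurve_eq fun t ht => by
    have := β.hasDerivWithinAt_of_bilinear (hasDerivWithinAt_extend f ht)
      (hasDerivWithinAt_extend g ht)
    exact this

theorem ContCurve.bilin {Z : Type*} [TopologicalSpace Z] (β : V₁ →L[ℝ] V₂ →L[ℝ] V₃) {k : ℕ}
    {Φ : Z → SmoothCurve V₁ V₁} {Ψ : Z → SmoothCurve V₂ V₂} (hΦ : ContCurve k Φ)
    (hΨ : ContCurve k Ψ) : ContCurve k fun z => bilinCurve β (Φ z) (Ψ z) := by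
  have hzero : ∀ {Φ : Z → SmoothCurve V₁ V₁} {Ψ : Z → SmoothCurve V₂ V₂}, ContCurve 0 Φ →
      ContCurve 0 Ψ → ContCurve 0 fun z => bilinCurve β (Φ z) (Ψ z) := by
    intro Φ Ψ hΦ hΨ
    rw [contCurve_zero_iff] at *
    refine ContinuousMap.continuous_of_continuous_uncurry _ ?_
    have h1 : Continuous fun p : Z × unitInterval => toCont V₁ (Φ p.1) p.2 :=
      (hΦ.comp continuous_fst).eval continuous_snd
    have h2 : Continuous fun p : Z × unitInterval => toCont V₂ (Ψ p.1) p.2 :=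
      (hΨ.comp continuous_fst).eval continuous_snd
    exact (β.continuous.comp h1).clm_apply h2
  induction k generalizing Φ Ψ with
  | zero => exact hzero hΦ hΨ
  | succ k ih =>
    have h1 := contCurve_succ_iff.1 hΦ
    have h2 := contCurve_succ_iff.1 hΨ
    rw [contCurve_succ_iff]
    refine ⟨hzero h1.1 h2.1, ?_⟩
    simp only [derivCurve_bilinCurve]
    exact (ih hΦ.of_succ h2.2).add (ih h1.2 hΨ.of_succ)

theorem continuous_bilinCurve (β : V₁ →L[ℝ] V₂ →L[ℝ] V₃) :
    Continuous fun p : SmoothCurve V₁ V₁ × SmoothCurve V₂ V₂ => bilinCurve β p.1 p.2 :=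
  continuous_iff_contCurve.2 fun k =>
    ContCurve.bilin β (continuous_iff_contCurve.1 continuous_fst k)
      (continuous_iff_contCurve.1 continuous_snd k)

/-- The sup norm of a curve that starts at `0` is at most the one of its derivative. -/
theorem norm_toCont_le {f : SmoothCurve V V} (h0 : f 0 = 0) :
    ‖toCont V f‖ ≤ ‖toCont V (derivCurve f)‖ := by
  refine (ContinuousMap.norm_le _ (norm_nonneg _)).2 fun t => ?_
  have h := (convex_Icc (0 : ℝ) 1).norm_image_sub_le_of_norm_hasDerivWithin_le
    (fun s hs => hasDerivWithinAt_extend f hs) (C := ‖toCont V (derivCurve f)‖)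
    (fun s hs => by
      rw [extend_of_mem _ hs]; exact (toCont V (derivCurve f)).norm_coe_le_norm ⟨s, hs⟩)
    (left_mem_Icc.2 zero_le_one) t.2
  have e0 : IccExtend zero_le_one f (0 : ℝ) = 0 := (extend_coe f 0).trans h0
  rw [e0, extend_coe, sub_zero, sub_zero] at h
  refine h.trans (mul_le_of_le_one_right (norm_nonneg _) ?_)
  rw [Real.norm_eq_abs, abs_le]
  exact ⟨by linarith [t.2.1], t.2.2⟩

theorem eq_of_derivCurve_eq {f g : SmoothCurve V V} (h : derivCurve f = derivCurve g)
    (h0 : f 0 = g 0) : f = g := by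
  have h1 : derivCurve (f - g) = 0 := by
    change derivL V (f - g) = 0
    rw [map_sub, sub_eq_zero]; exact h
  have h2 := norm_toCont_le (f := f - g) (by
    change f 0 - g 0 = 0
    rw [h0, sub_self])
  rw [h1, map_zero, norm_zero, norm_le_zero_iff] at h2
  have h3 : f - g = 0 := by
    ext t
    exact congrArg (fun φ : C(unitInterval, V) => φ t) h2
  exact sub_eq_zero.1 h3

theorem exists_antideriv [CompleteSpace V] (f : SmoothCurve V V) :
    ∃ g : SmoothCurve V V, derivCurve g = f ∧ g 0 = 0 := by
  have hc : Continuous (IccExtend zero_le_one f) := f.contMDiff.continuous.Icc_extend'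
  set g : ℝ → V := fun t => ∫ s in (0 : ℝ)..t, IccExtend zero_le_one f s with hg
  have hd : ∀ t, HasDerivAt g (IccExtend zero_le_one f t) t := fun t =>
    hc.integral_hasStrictDerivAt 0 t |>.hasDerivAt
  have hs : ContDiffOn ℝ ∞ g (Icc 0 1) := by
    rw [contDiffOn_infty_iff_derivWithin uniqueDiffOn_Icc_zero_one]
    refine ⟨fun t _ => (hd t).differentiableAt.differentiableWithinAt, ?_⟩
    exact f.contDiffOn_extend.congr fun t ht =>
      (hd t).hasDerivWithinAt.derivWithin (uniqueDiffOn_Icc_zero_one t ht)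
  refine ⟨SmoothCurve.ofReal g hs.contMDiffOn, derivCurve_eq fun t ht => ?_, ?_⟩
  · exact (hd t).hasDerivWithinAt.congr (fun s hs => extend_of_mem _ hs) (extend_of_mem _ ht)
  · change g 0 = 0
    simp [hg]

/-- The antiderivative that vanishes at `0`, as a linear map. -/
def antiderivL [CompleteSpace V] : SmoothCurve V V →ₗ[ℝ] SmoothCurve V V where
  toFun f := (exists_antideriv f).choose
  map_add' f g := by
    have hf := (exists_antideriv f).choose_spec
    have hg := (exists_antideriv g).choose_spec
    have hfg := (exists_antideriv (f + g)).choose_spec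
    refine eq_of_derivCurve_eq ?_ ?_
    · rw [hfg.1]
      change _ = derivL V (_ + _)
      rw [map_add]
      exact (congrArg₂ (· + ·) hf.1 hg.1).symm
    · rw [hfg.2]
      change 0 = (exists_antideriv f).choose 0 + (exists_antideriv g).choose 0
      rw [hf.2, hg.2, add_zero]
  map_smul' a f := by
    have hf := (exists_antideriv f).choose_spec
    have haf := (exists_antideriv (a • f)).choose_spec
    refine eq_of_derivCurve_eq ?_ ?_
    · rw [haf.1]
      change _ = derivL V (_ • _)
      rw [map_smul]
      exact (congrArg (a • ·) hf.1).symm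
    · rw [haf.2]
      change 0 = a • (exists_antideriv f).choose 0
      rw [hf.2, smul_zero]

theorem derivCurve_antiderivL [CompleteSpace V] (f : SmoothCurve V V) :
    derivCurve (antiderivL f) = f :=
  (exists_antideriv f).choose_spec.1

theorem antiderivL_apply_zero [CompleteSpace V] (f : SmoothCurve V V) : antiderivL f 0 = 0 :=
  (exists_antideriv f).choose_spec.2

theorem norm_toCont_antiderivL_le [CompleteSpace V] (f : SmoothCurve V V) :
    ‖toCont V (antiderivL f)‖ ≤ ‖toCont V f‖ := by
  simpa only [derivCurve_antiderivL] using norm_toCont_le (antiderivL_apply_zero f)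

/-- Integration over an interval of length one does not increase the sup norm. Higher orders follow
because differentiation returns the integrand. -/
theorem contCurve_zero_antiderivL [CompleteSpace V] :
    ContCurve 0 fun f : SmoothCurve V V => antiderivL f := by
  rw [contCurve_zero_iff, continuous_iff_continuousAt]
  intro f₀
  refine tendsto_iff_norm_sub_tendsto_zero.2 ?_
  have h := contCurve_zero_iff.1 (continuous_iff_contCurve.1
    (continuous_id (X := SmoothCurve V V)) 0)
  refine squeeze_zero (fun _ => norm_nonneg _) (fun f => ?_)
    (tendsto_iff_norm_sub_tendsto_zero.1 (h.tendsto f₀))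
  rw [← map_sub, ← map_sub, ← map_sub]
  exact norm_toCont_antiderivL_le _

/-- The antiderivative that vanishes at `0`. -/
def antideriv [CompleteSpace V] : SmoothCurve V V →L[ℝ] SmoothCurve V V where
  toLinearMap := antiderivL
  cont := continuous_iff_contCurve.2 fun k => by
    cases k with
    | zero => exact contCurve_zero_antiderivL
    | succ k =>
      refine contCurve_succ_iff.2 ⟨contCurve_zero_antiderivL, ?_⟩
      refine (continuous_iff_contCurve.1 (continuous_id (X := SmoothCurve V V)) k).congr ?_
      exact fun f => (derivCurve_antiderivL f).symm

theorem derivCurve_antideriv [CompleteSpace V] (f : SmoothCurve V V) :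
    derivCurve (antideriv f) = f := derivCurve_antiderivL f

theorem antideriv_apply_zero [CompleteSpace V] (f : SmoothCurve V V) : antideriv f 0 = 0 :=
  antiderivL_apply_zero f

theorem norm_toCont_antideriv_le [CompleteSpace V] (f : SmoothCurve V V) :
    ‖toCont V (antideriv f)‖ ≤ ‖toCont V f‖ := norm_toCont_antiderivL_le f

end Frechet

/-! ### Duhamel's formula and smoothness of `Ψ` -/

section AdCurves

/-- The pointwise image of a smooth curve under a continuous linear map. -/
def mapCurve {V W : Type*} [NormedAddCommGroup V] [NormedSpace ℝ V] [NormedAddCommGroup W]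
    [NormedSpace ℝ W] (L : V →L[ℝ] W) : SmoothCurve V V →L[ℝ] SmoothCurve W W where
  toLinearMap := bilinCurve (ContinuousLinearMap.id ℝ (V →L[ℝ] W)) (ContMDiffMap.const L)
  cont := (continuous_bilinCurve (ContinuousLinearMap.id ℝ (V →L[ℝ] W))).comp
    (continuous_const.prodMk continuous_id)

/-- The pointwise product of smooth curves in a normed algebra. -/
abbrev mulCurve {A : Type*} [NormedRing A] [NormedAlgebra ℝ A] :
    SmoothCurve A A →ₗ[ℝ] SmoothCurve A A →ₗ[ℝ] SmoothCurve A A :=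
  bilinCurve (ContinuousLinearMap.mul ℝ A)

theorem norm_toCont_mulCurve_le {A : Type*} [NormedRing A] [NormedAlgebra ℝ A]
    (f g : SmoothCurve A A) : ‖toCont A (mulCurve f g)‖ ≤ ‖toCont A f‖ * ‖toCont A g‖ :=
  norm_mul_le (toCont A f) (toCont A g)

theorem norm_toCont_antideriv_mul_le {A : Type*} [NormedRing A] [NormedAlgebra ℝ A]
    [CompleteSpace A] (f g h : SmoothCurve A A) :
    ‖toCont A (antideriv (mulCurve (mulCurve f g) h))‖
      ≤ ‖toCont A f‖ * ‖toCont A g‖ * ‖toCont A h‖ :=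
  (norm_toCont_antideriv_le _).trans ((norm_toCont_mulCurve_le _ _).trans
    (mul_le_mul_of_nonneg_right (norm_toCont_mulCurve_le _ _) (norm_nonneg _)))

theorem continuous_mulCurve {A : Type*} [NormedRing A] [NormedAlgebra ℝ A] :
    Continuous fun p : SmoothCurve A A × SmoothCurve A A => mulCurve p.1 p.2 :=
  continuous_bilinCurve _

theorem continuous_mulCurve_comp {Z A : Type*} [TopologicalSpace Z] [NormedRing A] [NormedAlgebra ℝ A]
    {f g : Z → SmoothCurve A A} (hf : Continuous f) (hg : Continuous g) :
    Continuous fun z => ReductiveSRVT.mulCurve (f z) (g z) :=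
  continuous_mulCurve.comp (hf.prodMk hg)

/-- Absorption: once `ε < 1/2`, the bound and `‖x‖ ≤ ‖x - x₀‖ + ‖x₀‖` give `‖x - x₀‖ ≤ 2 ‖x₀‖ ε`. No
a priori bound on `x` is needed. -/
theorem tendsto_of_norm_sub_le_mul {Z X : Type*} [NormedAddCommGroup X] {l : Filter Z}
    {x : Z → X} {x₀ : X} {ε : Z → ℝ} (hε : Filter.Tendsto ε l (𝓝 0))
    (h : ∀ z, ‖x z - x₀‖ ≤ ‖x z‖ * ε z) (h0 : ∀ z, 0 ≤ ε z) : Filter.Tendsto x l (𝓝 x₀) := by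
  refine tendsto_iff_norm_sub_tendsto_zero.2 ?_
  have h1 : Filter.Tendsto (fun z => 2 * ‖x₀‖ * ε z) l (𝓝 0) := by
    simpa using hε.const_mul (2 * ‖x₀‖)
  refine squeeze_zero' (Filter.Eventually.of_forall fun _ => norm_nonneg _) ?_ h1
  filter_upwards [hε.eventually (gt_mem_nhds (show (0 : ℝ) < 1 / 2 by norm_num))] with z hz
  have h2 : ‖x z‖ ≤ ‖x z - x₀‖ + ‖x₀‖ := by
    simpa using norm_add_le (x z - x₀) x₀
  have h3 := h z
  have h4 := mul_le_mul_of_nonneg_right h2 (h0 z)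
  have h5 := mul_le_mul_of_nonneg_left hz.le (norm_nonneg (x z - x₀))
  nlinarith

variable {E : Type*} [NormedAddCommGroup E] [NormedSpace ℝ E] [FiniteDimensional ℝ E]
  {G : Type*} [TopologicalSpace G] [ChartedSpace E G] [Group G] [LieGroup 𝓘(ℝ, E) ∞ G]

variable (G) in
/-- The curve `Ad(Evol(q))`. -/
def AdEvol (q : SmoothCurve E E) : SmoothCurve (E →L[ℝ] E) (E →L[ℝ] E) :=
  ⟨fun t => Ad (Evol q t : G), contMDiff_Ad.comp (Evol q : SmoothCurve E G).contMDiff⟩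

variable (G) in
/-- The curve `Ad(Evol(q)⁻¹)`. -/
def AdEvolInv (q : SmoothCurve E E) : SmoothCurve (E →L[ℝ] E) (E →L[ℝ] E) :=
  ⟨fun t => Ad (Evol q t : G)⁻¹, contMDiff_Ad.comp (Evol q : SmoothCurve E G).contMDiff.inv⟩

variable (E G) in
/-- `ad`, pointwise on curves. -/
def adCurve : SmoothCurve E E →L[ℝ] SmoothCurve (E →L[ℝ] E) (E →L[ℝ] E) := mapCurve (ad E G)

theorem AdEvolInv_mul_AdEvol (q : SmoothCurve E E) (t : unitInterval) :
    AdEvolInv G q t * AdEvol G q t = 1 := by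
  change Ad (Evol q t : G)⁻¹ ∘L Ad (Evol q t : G) = _
  rw [← Ad_mul, inv_mul_cancel, Ad_one]; rfl

theorem AdEvol_mul_AdEvolInv (q : SmoothCurve E E) (t : unitInterval) :
    AdEvol G q t * AdEvolInv G q t = 1 := by
  change Ad (Evol q t : G) ∘L Ad (Evol q t : G)⁻¹ = _
  rw [← Ad_mul, mul_inv_cancel, Ad_one]; rfl

theorem AdEvol_zero (q : SmoothCurve E E) : AdEvol G q 0 = 1 := by
  change Ad (Evol q 0 : G) = _
  rw [(isEvolution_Evol q).1, Ad_one]; rfl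

theorem AdEvolInv_zero (q : SmoothCurve E E) : AdEvolInv G q 0 = 1 := by
  change Ad (Evol q 0 : G)⁻¹ = _
  rw [(isEvolution_Evol q).1, inv_one, Ad_one]; rfl

theorem derivCurve_AdEvol (q : SmoothCurve E E) :
    derivCurve (AdEvol G q) = mulCurve (adCurve E G q) (AdEvol G q) :=
  derivCurve_eq fun _ ht => (hasLogDeriv_evol (G := G) q ht).hasDerivWithinAt_Ad

/-- Differentiate `Ad(Evol(q)⁻¹) Ad(Evol(q)) = 1` and cancel on the right. -/
theorem derivCurve_AdEvolInv (q : SmoothCurve E E) :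
    derivCurve (AdEvolInv G q) = -mulCurve (AdEvolInv G q) (adCurve E G q) := by
  have h1 : mulCurve (AdEvolInv G q) (AdEvol G q) = ContMDiffMap.const 1 := by
    ext1 t; exact AdEvolInv_mul_AdEvol q t
  have h2 := derivCurve_bilinCurve (ContinuousLinearMap.mul ℝ (E →L[ℝ] E)) (AdEvolInv G q)
    (AdEvol G q)
  have h3 : derivCurve (ContMDiffMap.const 1 : SmoothCurve (E →L[ℝ] E) (E →L[ℝ] E)) = 0 :=
    derivCurve_eq fun _ _ => hasDerivWithinAt_const _ _ _
  rw [h1, h3, derivCurve_AdEvol] at h2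
  ext1 t
  have h4 : (0 : E →L[ℝ] E) = AdEvolInv G q t * (adCurve E G q t * AdEvol G q t)
      + derivCurve (AdEvolInv G q) t * AdEvol G q t :=
    congrArg (fun f : SmoothCurve (E →L[ℝ] E) (E →L[ℝ] E) => f t) h2
  have h5 := congrArg (· * AdEvolInv G q t) h4
  simp only [zero_mul, add_mul, mul_assoc, AdEvol_mul_AdEvolInv, mul_one] at h5
  exact eq_neg_of_add_eq_zero_right h5.symm

instance completeSpace_endomorphisms : CompleteSpace (E →L[ℝ] E) :=
  FiniteDimensional.complete ℝ _

/-- Duhamel's formula for `Ad(Evol(·)⁻¹)`. -/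
theorem AdEvolInv_sub (p q : SmoothCurve E E) :
    AdEvolInv G p - AdEvolInv G q
      = mulCurve (antideriv (mulCurve (mulCurve (AdEvolInv G p) (adCurve E G (q - p)))
        (AdEvol G q))) (AdEvolInv G q) := by
  -- Variation of constants: with `B = AdEvolInv` and `Y = AdEvol`, the product `(B_p - B_q) Y_q`
  -- vanishes at 0 and has derivative `B_p ad(q - p) Y_q`.
  have h : mulCurve (AdEvolInv G p - AdEvolInv G q) (AdEvol G q)
      = antideriv (mulCurve (mulCurve (AdEvolInv G p) (adCurve E G (q - p))) (AdEvol G q)) := by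
    refine eq_of_derivCurve_eq ?_ ?_
    · rw [derivCurve_antideriv, derivCurve_bilinCurve]
      have e : derivCurve (AdEvolInv G p - AdEvolInv G q)
          = derivCurve (AdEvolInv G p) - derivCurve (AdEvolInv G q) :=
        map_sub (derivL (E →L[ℝ] E)) _ _
      rw [e, derivCurve_AdEvol, derivCurve_AdEvolInv, derivCurve_AdEvolInv,
        map_sub (adCurve E G)]
      ext1 t
      change (AdEvolInv G p t - AdEvolInv G q t) * (adCurve E G q t * AdEvol G q t)
        + (-(AdEvolInv G p t * adCurve E G p t) - -(AdEvolInv G q t * adCurve E G q t))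
          * AdEvol G q t
        = AdEvolInv G p t * (adCurve E G q t - adCurve E G p t) * AdEvol G q t
      noncomm_ring
    · rw [antideriv_apply_zero]
      change (AdEvolInv G p 0 - AdEvolInv G q 0) * AdEvol G q 0 = 0
      rw [AdEvolInv_zero, AdEvolInv_zero, sub_self, zero_mul]
  rw [← h]
  ext1 t
  change AdEvolInv G p t - AdEvolInv G q t
    = (AdEvolInv G p t - AdEvolInv G q t) * AdEvol G q t * AdEvolInv G q t
  rw [mul_assoc, AdEvol_mul_AdEvolInv, mul_one]

/-- Duhamel's formula for `Ad(Evol(·))`. -/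
theorem AdEvol_sub (p q : SmoothCurve E E) :
    AdEvol G p - AdEvol G q
      = mulCurve (AdEvol G q) (antideriv (mulCurve (mulCurve (AdEvolInv G q)
        (adCurve E G (p - q))) (AdEvol G p))) := by
  have h : mulCurve (AdEvolInv G q) (AdEvol G p - AdEvol G q)
      = antideriv (mulCurve (mulCurve (AdEvolInv G q) (adCurve E G (p - q))) (AdEvol G p)) := by
    refine eq_of_derivCurve_eq ?_ ?_
    · rw [derivCurve_antideriv, derivCurve_bilinCurve]
      have e : derivCurve (AdEvol G p - AdEvol G q)
          = derivCurve (AdEvol G p) - derivCurve (AdEvol G q) :=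
        map_sub (derivL (E →L[ℝ] E)) _ _
      rw [e, derivCurve_AdEvol, derivCurve_AdEvol, derivCurve_AdEvolInv,
        map_sub (adCurve E G)]
      ext1 t
      change AdEvolInv G q t * (adCurve E G p t * AdEvol G p t - adCurve E G q t * AdEvol G q t)
        + -(AdEvolInv G q t * adCurve E G q t) * (AdEvol G p t - AdEvol G q t)
        = AdEvolInv G q t * (adCurve E G p t - adCurve E G q t) * AdEvol G p t
      noncomm_ring
    · rw [antideriv_apply_zero]
      change AdEvolInv G q 0 * (AdEvol G p 0 - AdEvol G q 0) = 0
      rw [AdEvol_zero, AdEvol_zero, sub_self, mul_zero]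
  rw [← h]
  ext1 t
  change AdEvol G p t - AdEvol G q t
    = AdEvol G q t * (AdEvolInv G q t * (AdEvol G p t - AdEvol G q t))
  rw [← mul_assoc, AdEvol_mul_AdEvolInv, one_mul]

theorem tendsto_norm_adCurve_sub (q : SmoothCurve E E) (K : ℝ) :
    Filter.Tendsto (fun p => ‖toCont (E →L[ℝ] E) (adCurve E G (p - q))‖ * K) (𝓝 q) (𝓝 0) := by
  have h1 : Continuous fun p : SmoothCurve E E => adCurve E G (p - q) :=
    (adCurve E G).continuous.comp (continuous_id.sub continuous_const)
  have h2 := (contCurve_zero_iff.1 (continuous_iff_contCurve.1 h1 0)).norm.mul_const K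
  have h3 := h2.tendsto q
  rwa [sub_self, map_zero, map_zero, norm_zero, zero_mul] at h3

/-- Duhamel bounds the difference by a small multiple of the unknown `‖AdEvolInv G p‖`, and the
absorption lemma removes that factor. -/
theorem contCurve_zero_AdEvolInv : ContCurve 0 fun q : SmoothCurve E E => AdEvolInv G q := by
  rw [contCurve_zero_iff, continuous_iff_continuousAt]
  intro q
  refine tendsto_of_norm_sub_le_mul (tendsto_norm_adCurve_sub (G := G) q
    (‖toCont _ (AdEvol G q)‖ * ‖toCont _ (AdEvolInv G q)‖)) (fun p => ?_) fun p => by positivity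
  rw [← map_sub, AdEvolInv_sub, ← neg_sub p q, map_neg]
  refine (norm_toCont_mulCurve_le _ _).trans ((mul_le_mul_of_nonneg_right
    (norm_toCont_antideriv_mul_le _ _ _) (norm_nonneg _)).trans_eq ?_)
  rw [map_neg, norm_neg]
  ring

theorem contCurve_zero_AdEvol : ContCurve 0 fun q : SmoothCurve E E => AdEvol G q := by
  rw [contCurve_zero_iff, continuous_iff_continuousAt]
  intro q
  refine tendsto_of_norm_sub_le_mul (tendsto_norm_adCurve_sub (G := G) q
    (‖toCont _ (AdEvol G q)‖ * ‖toCont _ (AdEvolInv G q)‖)) (fun p => ?_) fun p => by positivity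
  rw [← map_sub, AdEvol_sub]
  refine (norm_toCont_mulCurve_le _ _).trans ((mul_le_mul_of_nonneg_left
    (norm_toCont_antideriv_mul_le _ _ _) (norm_nonneg _)).trans_eq ?_)
  ring

/-- The differential equation expresses each further derivative in `t` through lower ones, which
lifts sup norm continuity to all orders. -/
theorem continuous_AdEvolInv : Continuous fun q : SmoothCurve E E => AdEvolInv G q := by
  refine continuous_iff_contCurve.2 fun k => ?_
  induction k with
  | zero => exact contCurve_zero_AdEvolInv
  | succ k ih =>
    refine contCurve_succ_iff.2 ⟨contCurve_zero_AdEvolInv, ?_⟩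
    have h := continuous_iff_contCurve.1
      ((adCurve E G).continuous.comp (continuous_neg (G := SmoothCurve E E))) k
    refine (ih.bilin (ContinuousLinearMap.mul ℝ (E →L[ℝ] E)) h).congr fun q => ?_
    rw [derivCurve_AdEvolInv, Function.comp_apply, map_neg, map_neg]

theorem continuous_AdEvol : Continuous fun q : SmoothCurve E E => AdEvol G q := by
  refine continuous_iff_contCurve.2 fun k => ?_
  induction k with
  | zero => exact contCurve_zero_AdEvol
  | succ k ih =>
    refine contCurve_succ_iff.2 ⟨contCurve_zero_AdEvol, ?_⟩
    have h := continuous_iff_contCurve.1 (adCurve E G).continuous k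
    exact (h.bilin (ContinuousLinearMap.mul ℝ (E →L[ℝ] E)) ih).congr fun q =>
      (derivCurve_AdEvol q).symm

theorem tendsto_add_smul (q w : SmoothCurve E E) :
    Filter.Tendsto (fun s : ℝ => q + s • w) (𝓝[≠] 0) (𝓝 q) := by
  have h1 : Continuous fun s : ℝ => q + s • w := by fun_prop
  have h2 := h1.tendsto 0
  rw [zero_smul, add_zero] at h2
  exact h2.mono_left nhdsWithin_le_nhds

/-- At `p = q + s w` Duhamel's difference is exactly `s` times a continuous function of `p`, so the
difference quotient converges by continuity alone, without a remainder estimate. -/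
theorem hasDirDeriv_AdEvolInv :
    HasDirDeriv (fun q : SmoothCurve E E => AdEvolInv G q) fun p =>
      mulCurve (antideriv (mulCurve (mulCurve (AdEvolInv G p.1) (adCurve E G (-p.2)))
        (AdEvol G p.1))) (AdEvolInv G p.1) := by
  intro q w
  have h1 : Continuous fun p : SmoothCurve E E =>
      mulCurve (antideriv (mulCurve (mulCurve (AdEvolInv G p) (adCurve E G (-w)))
        (AdEvol G q))) (AdEvolInv G q) := by
    exact continuous_mulCurve_comp (antideriv.continuous.comp (continuous_mulCurve_comp
      (continuous_mulCurve_comp continuous_AdEvolInv continuous_const) continuous_const))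
      continuous_const
  refine ((h1.tendsto q).comp (tendsto_add_smul q w)).congr' ?_
  filter_upwards [self_mem_nhdsWithin] with s hs
  have e : q - (q + s • w) = s • (-w) := by rw [sub_add_cancel_left, smul_neg]
  rw [AdEvolInv_sub, e]
  simp only [Function.comp_apply, map_smul, LinearMap.smul_apply]
  rw [smul_smul, inv_mul_cancel₀ hs, one_smul]

theorem hasDirDeriv_AdEvol :
    HasDirDeriv (fun q : SmoothCurve E E => AdEvol G q) fun p =>
      mulCurve (AdEvol G p.1) (antideriv (mulCurve (mulCurve (AdEvolInv G p.1)
        (adCurve E G p.2)) (AdEvol G p.1))) := by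
  intro q w
  have h1 : Continuous fun p : SmoothCurve E E =>
      mulCurve (AdEvol G q) (antideriv (mulCurve (mulCurve (AdEvolInv G q)
        (adCurve E G w)) (AdEvol G p))) := by
    exact continuous_mulCurve_comp continuous_const (antideriv.continuous.comp
      (continuous_mulCurve_comp continuous_const continuous_AdEvol))
  refine ((h1.tendsto q).comp (tendsto_add_smul q w)).congr' ?_
  filter_upwards [self_mem_nhdsWithin] with s hs
  rw [AdEvol_sub, add_sub_cancel_left]
  simp only [Function.comp_apply, map_smul, LinearMap.smul_apply]
  rw [smul_smul, inv_mul_cancel₀ hs, one_smul]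

theorem DirContDiff.mulCurve {A : Type*} [NormedRing A] [NormedAlgebra ℝ A]
    {X : Type*} [AddCommGroup X] [Module ℝ X] [TopologicalSpace X]
    [IsTopologicalAddGroup X] [ContinuousSMul ℝ X] {n : ℕ} {f g : X → SmoothCurve A A}
    (hf : DirContDiff n f) (hg : DirContDiff n g) :
    DirContDiff n fun x => ReductiveSRVT.mulCurve (f x) (g x) :=
  hf.bilinear _ continuous_mulCurve hg

/-- Both directional derivatives combine both curves with a linear term by products and an
antiderivative, so the two claims are proved by simultaneous induction. -/
theorem dirContDiff_AdEvol (n : ℕ) :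
    DirContDiff n (fun q : SmoothCurve E E => AdEvolInv G q) ∧
      DirContDiff n (fun q : SmoothCurve E E => AdEvol G q) := by
  induction n with
  | zero => exact ⟨continuous_AdEvolInv, continuous_AdEvol⟩
  | succ n ih =>
    have hB := ih.1.comp_linear (ContinuousLinearMap.fst ℝ (SmoothCurve E E) (SmoothCurve E E))
    have hC := ih.2.comp_linear (ContinuousLinearMap.fst ℝ (SmoothCurve E E) (SmoothCurve E E))
    have ha := dirContDiff_linear n
      (adCurve E G ∘L ContinuousLinearMap.snd ℝ (SmoothCurve E E) (SmoothCurve E E))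
    have hn := dirContDiff_linear n
      (adCurve E G ∘L (-ContinuousLinearMap.snd ℝ (SmoothCurve E E) (SmoothCurve E E)))
    exact ⟨⟨continuous_AdEvolInv, _, hasDirDeriv_AdEvolInv,
        (((hB.mulCurve hn).mulCurve hC).linear_comp antideriv).mulCurve hB⟩,
      ⟨continuous_AdEvol, _, hasDirDeriv_AdEvol,
        hC.mulCurve (((hB.mulCurve ha).mulCurve hC).linear_comp antideriv)⟩⟩

/-- `Ψ` is the fixed linear map `-Ad(g₀)` applied to the continuous bilinear pairing of
`Ad(Evol(q)⁻¹)` with `q`. -/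
theorem bastianiSmooth_Psi (g₀ : G) : BastianiSmooth (Psi (E := E) g₀) := by
  refine DirSmooth.bastianiSmooth fun n => ?_
  have h := ((dirContDiff_AdEvol (E := E) (G := G) n).1.bilinear
    (bilinCurve (ContinuousLinearMap.id ℝ (E →L[ℝ] E))) (continuous_bilinCurve _)
    (dirContDiff_linear n (ContinuousLinearMap.id ℝ (SmoothCurve E E)))).linear_comp
    (mapCurve (-(Ad g₀ : E →L[ℝ] E)))
  have e : Psi (E := E) g₀ = fun q => mapCurve (-(Ad g₀ : E →L[ℝ] E))
      (bilinCurve (ContinuousLinearMap.id ℝ (E →L[ℝ] E)) (AdEvolInv G q) q) := by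
    funext q
    ext t
    rw [Psi_apply, evol_coe, Ad_mul_apply]
    rfl
  rw [e]
  exact h

end AdCurves

end ReductiveSRVT

end

theorem lemmaA4
    {E : Type*} [NormedAddCommGroup E] [NormedSpace ℝ E] [FiniteDimensional ℝ E]
    {G : Type*} [TopologicalSpace G] [ChartedSpace E G] [Group G] [LieGroup 𝓘(ℝ, E) ∞ G]
    {F : Type*} [NormedAddCommGroup F] [NormedSpace ℝ F] [FiniteDimensional ℝ F]
    (H : Subgroup G) (hH : IsClosed (H : Set G))
    [ChartedSpace F (G ⧸ H)] [IsManifold 𝓘(ℝ, F) ∞ (G ⧸ H)]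
    (hπ : Manifold.IsSubmersion 𝓘(ℝ, E) 𝓘(ℝ, F) ∞ (QuotientGroup.mk : G → G ⧸ H))
    (𝔪 : Submodule ℝ E) (h𝔪 : IsReductiveComplement H 𝔪)
    (c₀ : G ⧸ H) (g₀ : G) (hg₀ : (QuotientGroup.mk g₀ : G ⧸ H) = c₀) :
    -- `Evol` and `ω` are well defined
    (∀ q : SmoothCurve E E, ∃! g : SmoothCurve E G, IsEvolution q g) ∧
    (∀ (g : G) (x : G ⧸ H), (QuotientGroup.mk g : G ⧸ H) = x →
      ∀ v : TangentSpace 𝓘(ℝ, F) x, omega 𝔪 x v = omegaAt 𝔪 g x v) ∧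
    -- `Ψ_{g₀}` is a diffeomorphism of `C^∞(I, 𝔤)` with inverse `Ψ_{g₀⁻¹}`
    (Function.LeftInverse (Psi (E := E) g₀⁻¹) (Psi g₀) ∧
      Function.RightInverse (Psi (E := E) g₀⁻¹) (Psi g₀) ∧
      BastianiSmooth (Psi (E := E) g₀) ∧ BastianiSmooth (Psi (E := E) g₀⁻¹)) ∧
    -- the image of `C^∞(I, 𝔪 ∖ {0})` under `Ψ_{g₀}`
    (fun q : SmoothCurve E E => (Psi g₀ q : unitInterval → E)) ''
        {q : SmoothCurve E E | ∀ t, q t ∈ 𝔪 ∧ q t ≠ 0}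
      = {f : unitInterval → E | ∃ c : SmoothCurve F (G ⧸ H), IsImm c ∧ c 0 = c₀ ∧
          f = thetaD 𝔪 c} ∧
    -- `θ_ω ∘ D ∘ ρ_{c₀} ∘ Ψ_{g₀} = Ψ_{g₀}` on `𝔪`-valued curves
    ∀ q : SmoothCurve E E, (∀ t, q t ∈ 𝔪) → thetaD 𝔪 (rho hπ c₀ (Psi g₀ q)) = Psi g₀ q := by
  subst hg₀
  exact ⟨fun q => ⟨Evol q, isEvolution_Evol q, fun _ hg => hg.unique (isEvolution_Evol q)⟩,
    fun _ _ hg v => omega_eq_omegaAt hπ h𝔪 hg v,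
    ⟨Psi_inv_Psi g₀, Psi_Psi_inv g₀, bastianiSmooth_Psi g₀, bastianiSmooth_Psi g₀⁻¹⟩,
    image_Psi_eq hπ h𝔪 g₀, thetaD_rho_Psi hπ h𝔪 g₀⟩
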